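/- Let $\frac12<\alpha<1$, $T>0$, $J=[0,T]$. Let $\mathbb X$ be a real separable reflexive Banach space whose dual $\mathbb X^*$ is strictly convex, $\mathbb U$ a real separable Hilbert space (identified with its dual), $\mathrm A$ the infinitesimal generator of a $C_0$-semigroup $\mathcal T(t)$, $t\ge 0$, on $\mathbb X$, and $\mathrm B:\mathbb U\to\mathbb X$ bounded and linear. For $\xi>0$ put $$\phi_\alpha(\xi)=\frac1\pi\sum_{n=1}^\infty(-1)^{n-1}\xi^{-n\alpha-1}\frac{\Gamma(n\alpha+1)}{n!}\sin(n\pi\alpha),\qquad \varphi_\alpha(\xi)=\tfrac1\alpha\,\xi^{-1-1/\alpha}\phi_\alpha(\xi^{-1/\alpha}),$$ and for $t\ge0$, $x\in\mathbb X$, $$\mathcal T_\alpha(t)x=\int_0^\infty\varphi_\alpha(\xi)\,\mathcal T(t^\alpha\xi)x\,d\xi,\qquad \widehat{\mathcal T}_\alpha(t)x=\alpha\int_0^\infty\xi\varphi_\alpha(\xi)\,\mathcal T(t^\alpha\xi)x\,d\xi .$$ Consider the linear fractional control system ${}^CD^\alpha_{0,t}x(t)=\mathrm Ax(t)+\mathrm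 Bu(t)$, $t\in J$, $x(0)=\zeta$, where $\zeta\in\mathbb X$ and $u\in L^2(J;\mathbb U)$; its mild solution is the function $x(\cdot;\zeta,u)\in C(J;\mathbb X)$ given by $$x(t)=\mathcal T_\alpha(t)\zeta+\int_0^t(t-s)^{\alpha-1}\widehat{\mathcal T}_\alpha(t-s)\mathrm Bu(s)\,ds .$$ The system is approximately controllable on $J$ from $\zeta$ if $\{x(T;\zeta,u):u\in L^2(J;\mathbb U)\}$ is dense in $\mathbb X$, and approximately controllable on $J$ if this holds for every $\zeta\in\mathbb X$. Let $\mathcal J[x]=\{x^*\in\mathbb X^*:\langle x,x^*\rangle=\|x\|^2=\|x^*\|^2\}$ be the duality mapping and $$\Phi_0^Tx^*=\int_0^T(T-t)^{2(\alpha-1)}\widehat{\mathcal T}_\alpha(T-t)\mathrm B\mathrm B^*\widehat{\mathcal T}_\alpha(T-t)^*x^*\,dt,\qquad x^*\in\mathbb X^*.$$ Then each $\widehat{\mathcal T}_\alpha(t)$, $t\ge 0$, is a well-defined bounded linear operator (the defining integral converges absolutely); for every $\lambda>0$ and $h\in\mathbb X$ the equation $\lambda w+\Phi_0^T\mathcal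 J[w]=h$ has exactly one solution $w=:\mathcal R(\lambda,\Phi_0^T)h\in\mathbb X$; and the following are equivalent: 1. the system is approximately controllable on $J$; 2. (H0): for every $h\in\mathbb X$, $\lambda\mathcal R(\lambda,\Phi_0^T)h\to0$ in norm as $\lambda\downarrow0$; 3. for every $x^*\in\mathbb X^*$: if $\mathrm B^*\widehat{\mathcal T}_\alpha(T-t)^*x^*=0$ for all $0\le t<T$, then $x^*=0$. Moreover, for each fixed $\zeta\in\mathbb X$, the system is approximately controllable on $J$ from $\zeta$ if and only if (H0) holds. -/

import Mathlib

open MeasureTheory Filter Topology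

noncomputable section

namespace FracControl

/-- The one-sided stable probability density
`ϕ_q(ξ) = (1/π) ∑_{n ≥ 1} (-1)^{n-1} ξ^{-nq-1} Γ(nq+1)/n! sin(nπq)` (the sum over `n ≥ 1` is
written as a sum over `n + 1`, `n ≥ 0`); used for `0 < q < 1` and `ξ > 0` only. -/
def stableDensity (q ξ : ℝ) : ℝ :=
  (1 / Real.pi) * ∑' n : ℕ, (-1 : ℝ) ^ n * ξ ^ (-((n + 1 : ℝ) * q) - 1) *
    (Real.Gamma ((n + 1 : ℝ) * q + 1) / ((n + 1).factorial : ℝ)) *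
    Real.sin ((n + 1 : ℝ) * Real.pi * q)

/-- The density `φ_q(ξ) = (1/q) ξ^{-1-1/q} ϕ_q(ξ^{-1/q})` on `(0, ∞)`. -/
def subordDensity (q ξ : ℝ) : ℝ :=
  (1 / q) * ξ ^ (-1 - 1 / q) * stableDensity q (ξ ^ (-(1 / q)))

section Semigroup

variable {X : Type*} [NormedAddCommGroup X] [NormedSpace ℝ X]

/-- `S` is a `C₀`-semigroup of bounded linear operators on `X`; only the values `S t` with
`t ≥ 0` are meaningful. -/
structure IsC0Semigroup (S : ℝ → X →L[ℝ] X) : Prop where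
  map_zero : S 0 = ContinuousLinearMap.id ℝ X
  map_add : ∀ s t : ℝ, 0 ≤ s → 0 ≤ t → S (s + t) = (S s).comp (S t)
  tendsto_zero : ∀ x : X, Tendsto (fun t => S t x) (𝓝[>] 0) (𝓝 x)

/-- The (unbounded) operator `A` is the infinitesimal generator of `S`: the domain of `A` is the
set of all `x` for which `(S t x - x) / t` converges as `t ↓ 0`, and `A x` is the limit. -/
def IsInfinitesimalGenerator (A : X →ₗ.[ℝ] X) (S : ℝ → X →L[ℝ] X) : Prop :=
  ∀ x y : X, (x, y) ∈ A.graph ↔ Tendsto (fun t : ℝ => t⁻¹ • (S t x - x)) (𝓝[>] 0) (𝓝 y)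

/-- `T_q(t) x = ∫₀^∞ φ_q(ξ) S(t^q ξ) x dξ`. -/
def fracT (S : ℝ → X →L[ℝ] X) (q t : ℝ) (x : X) : X :=
  ∫ ξ in Set.Ioi (0 : ℝ), subordDensity q ξ • S (t ^ q * ξ) x

/-- The vector `q ∫₀^∞ ξ φ_q(ξ) S(t^q ξ) x dξ`. -/
def hatTVec (S : ℝ → X →L[ℝ] X) (q t : ℝ) (x : X) : X :=
  q • ∫ ξ in Set.Ioi (0 : ℝ), (ξ * subordDensity q ξ) • S (t ^ q * ξ) x

open Classical in
/-- The bounded linear operator `T̂_q(t) : x ↦ q ∫₀^∞ ξ φ_q(ξ) S(t^q ξ) x dξ` (the integral is a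
strong one). That this map is linear and bounded for `t ≥ 0` is not built into the definition: it
is asserted in the theorem. -/
def hatT (S : ℝ → X →L[ℝ] X) (q t : ℝ) : X →L[ℝ] X :=
  if h : ∃ L : X →L[ℝ] X, ∀ x, L x = hatTVec S q t x then h.choose else 0

/-- The duality mapping `J[x] = {x* : ⟨x, x*⟩ = ‖x‖² = ‖x*‖²}`. -/
def dualityMap (x : X) : Set (StrongDual ℝ X) :=
  {f | f x = ‖x‖ ^ 2 ∧ ‖f‖ ^ 2 = ‖x‖ ^ 2}

/-- `w` satisfies `λ w + Φ J[w] ∋ h`. -/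
def SolvesResolventEq (Φ : StrongDual ℝ X → X) (lam : ℝ) (h w : X) : Prop :=
  ∃ f ∈ dualityMap w, lam • w + Φ f = h

/-- The (nonlinear) resolvent `R(λ, Φ) = (λ I + Φ J)⁻¹`: `R(λ, Φ) h` is the solution `w` of
`λ w + Φ J[w] = h`. Its unique existence for `λ > 0` is asserted in the theorem. -/
def resolventOp (Φ : StrongDual ℝ X → X) (lam : ℝ) (h : X) : X :=
  Classical.epsilon (SolvesResolventEq Φ lam h)

end Semigroup

section Control

variable {X U : Type*} [NormedAddCommGroup X] [NormedSpace ℝ X]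
  [NormedAddCommGroup U] [InnerProductSpace ℝ U] [CompleteSpace U]

/-- The adjoint `B* : X* → U`, with `U*` identified with the Hilbert space `U`. -/
def adjointB (B : U →L[ℝ] X) (f : StrongDual ℝ X) : U :=
  (InnerProductSpace.toDual ℝ U).symm (f.comp B)

/-- `B* T̂_q(t)* x*`, where `T̂_q(t)* x* = x* ∘ T̂_q(t)`. -/
def obsOp (S : ℝ → X →L[ℝ] X) (B : U →L[ℝ] X) (q t : ℝ) (f : StrongDual ℝ X) : U :=
  adjointB B (f.comp (hatT S q t))

/-- `Φ₀ᵀ x* = ∫₀ᵀ (T-t)^{2(α-1)} T̂_α(T-t) B B* T̂_α(T-t)* x* dt`. -/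
def gramian (S : ℝ → X →L[ℝ] X) (B : U →L[ℝ] X) (α T : ℝ) (f : StrongDual ℝ X) : X :=
  ∫ t in (0 : ℝ)..T, (T - t) ^ (2 * (α - 1)) • hatT S α (T - t) (B (obsOp S B α (T - t) f))

/-- `x ∈ C([0,T]; X)` is the mild solution, with control `u`, of the linear system
`ᶜD^α x = A x + B u` on `[0, T]`, `x(0) = ζ`, where `A` generates `S`. -/
def IsMildSolution (S : ℝ → X →L[ℝ] X) (B : U →L[ℝ] X) (α T : ℝ) (ζ : X) (u : ℝ → U)
    (x : ℝ → X) : Prop :=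
  ContinuousOn x (Set.Icc 0 T) ∧
    ∀ t ∈ Set.Icc (0 : ℝ) T,
      x t = fracT S α t ζ + ∫ s in (0 : ℝ)..t, (t - s) ^ (α - 1) • hatT S α (t - s) (B (u s))

/-- The reachable set at time `T` from `ζ`, with controls in `L²([0,T]; U)`. -/
def reachableSet (S : ℝ → X →L[ℝ] X) (B : U →L[ℝ] X) (α T : ℝ) (ζ : X) : Set X :=
  {y | ∃ (u : ℝ → U) (x : ℝ → X), MemLp u 2 (volume.restrict (Set.Icc 0 T)) ∧
    IsMildSolution S B α T ζ u x ∧ x T = y}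

/-- Approximate controllability on `[0, T]` from the initial state `ζ`. -/
def ApproxControllableFrom (S : ℝ → X →L[ℝ] X) (B : U →L[ℝ] X) (α T : ℝ) (ζ : X) : Prop :=
  closure (reachableSet S B α T ζ) = Set.univ

/-- Approximate controllability on `[0, T]` (for every initial state). -/
def ApproxControllable (S : ℝ → X →L[ℝ] X) (B : U →L[ℝ] X) (α T : ℝ) : Prop :=
  ∀ ζ : X, ApproxControllableFrom S B α T ζ

/-- Assumption (H0): `λ R(λ, Φ₀ᵀ) h → 0` in norm as `λ ↓ 0`, for every `h`. -/
def H0 (S : ℝ → X →L[ℝ] X) (B : U →L[ℝ] X) (α T : ℝ) : Prop :=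
  ∀ h : X, Tendsto (fun lam : ℝ => lam • resolventOp (gramian S B α T) lam h) (𝓝[>] 0) (𝓝 0)

end Control

end FracControl

end

noncomputable section

namespace FracControl

/-! ### Power series of the density -/

/-! Put κ(s) = (T-s)^(α-1) T̂_α(T-s) B. Since α > 1/2 and T̂_α is bounded on [0,T], κ is square
integrable, so L u = ∫ κ u is defined on L², and the reachable set from ζ is T_α(T)ζ plus the range
of L; density does not depend on ζ. The operator Φ₀ᵀ is L L*, hence symmetric, with f(Φf) = ∫
‖κ(s)*f‖² ds. By Hahn–Banach, density of range L, density of range Φ and injectivity of L* are the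
same condition (`denseRange_kernelGramian`, `eq_zero_of_dense_kernelRange`). Norm continuity of T̂_α
on (0,∞) turns "κ(s)*f = 0 almost everywhere" into the pointwise dual condition.

The equation λw + ΦJ[w] = h is the optimality condition for minimising λ/2 ‖f‖² + 1/2 f(Φf) - f(h)
over X*. A minimiser exists by weak* compactness; uniqueness follows from monotonicity and strict
convexity of X*. Since h - λw lies in range Φ, (H0) makes that range dense; conversely
`sq_norm_smul_solution_le` bounds λ‖w‖ through any g with Φg near h.

The analytic cost lies in T̂_α. The semigroup may grow exponentially, so the density must decay
faster than every exponential (`exists_abs_wrightM_le`). This is read off from its representation as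
the imaginary part of ∫ e^(σ - xσ^α) dσ along a ray shifted far to the right. Moving t from the
semigroup to the kernel by a dilation gives norm continuity. Finally, every L² control must have a
continuous mild solution, which is the continuity of a weakly singular convolution. -/

theorem Gamma_add_le_rpow_mul_Gamma {x a : ℝ} (hx : 0 < x) (ha : 0 < a) (ha' : a < 1) :
    Real.Gamma (x + a) ≤ x ^ a * Real.Gamma x := by
  -- Log-convexity of Γ between x and x + 1.
  have h := Real.Gamma_mul_add_mul_le_rpow_Gamma_mul_rpow_Gamma (s := x) (t := x + 1) (a := 1 - a)
    (b := a) hx (by linarith) (by linarith) ha (by ring)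
  have hG := Real.Gamma_pos_of_pos hx
  rw [Real.Gamma_add_one hx.ne', Real.mul_rpow hx.le hG.le] at h
  calc Real.Gamma (x + a) = Real.Gamma ((1 - a) * x + a * (x + 1)) := by ring_nf
    _ ≤ _ := h
    _ = x ^ a * (Real.Gamma x ^ (1 - a) * Real.Gamma x ^ a) := by ring
    _ = x ^ a * Real.Gamma x := by
      rw [← Real.rpow_add hG]; simp

/-- Ratio test: consecutive terms have ratio at most |r| (n+1)^(a-1), which tends to 0 because a <
1. The radius of convergence is therefore infinite. -/
theorem summable_pow_mul_Gamma_div_factorial {a : ℝ} (ha : 0 < a) (ha' : a < 1) (r : ℝ) :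
    Summable fun n : ℕ => r ^ n * (Real.Gamma (n * a + 1) / (n.factorial : ℝ)) := by
  have hlim : Tendsto (fun n : ℕ => |r| * ((n : ℝ) + 1) ^ (a - 1)) atTop (𝓝 0) := by
    have h1 : Tendsto (fun y : ℝ => y ^ (-(1 - a))) atTop (𝓝 0) :=
      tendsto_rpow_neg_atTop (by linarith)
    have h2 : Tendsto (fun n : ℕ => (n : ℝ) + 1) atTop atTop :=
      tendsto_atTop_add_const_right _ _ tendsto_natCast_atTop_atTop
    have h3 := (h1.comp h2).const_mul |r|
    simpa [Function.comp_def] using h3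
  have hev : ∀ᶠ n : ℕ in atTop, |r| * ((n : ℝ) + 1) ^ (a - 1) ≤ 1 / 2 :=
    hlim.eventually (eventually_le_nhds (by norm_num))
  refine summable_of_ratio_norm_eventually_le (r := 1 / 2) (by norm_num) ?_
  filter_upwards [hev] with n hn
  have hna : (0 : ℝ) < n * a + 1 := by positivity
  have hG : 0 < Real.Gamma (n * a + 1) := Real.Gamma_pos_of_pos hna
  have hG' : 0 < Real.Gamma ((n + 1 : ℕ) * a + 1) := Real.Gamma_pos_of_pos (by positivity)
  have hn1 : (0 : ℝ) < (n : ℝ) + 1 := by positivity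
  have hstep : Real.Gamma ((n + 1 : ℕ) * a + 1) ≤ ((n : ℝ) + 1) ^ a * Real.Gamma (n * a + 1) := by
    have := Gamma_add_le_rpow_mul_Gamma hna ha ha'
    calc Real.Gamma ((n + 1 : ℕ) * a + 1) = Real.Gamma (n * a + 1 + a) := by
          push_cast; ring_nf
      _ ≤ (n * a + 1) ^ a * Real.Gamma (n * a + 1) := this
      _ ≤ _ := by
        gcongr
        nlinarith [Nat.cast_nonneg (α := ℝ) n]
  rw [norm_mul, norm_mul, norm_pow, norm_pow, norm_div, norm_div, Real.norm_of_nonneg hG.le,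
    Real.norm_of_nonneg hG'.le, Nat.factorial_succ, Real.norm_eq_abs r]
  simp only [Nat.cast_mul, norm_mul, RCLike.norm_natCast]
  have hsplit : ((n : ℝ) + 1) ^ a = ((n : ℝ) + 1) ^ (a - 1) * ((n : ℝ) + 1) := by
    rw [← Real.rpow_add_one hn1.ne']; ring_nf
  have hf : (0 : ℝ) < n.factorial := by positivity
  calc |r| ^ (n + 1) * (Real.Gamma ((n + 1 : ℕ) * a + 1) / (((n + 1 : ℕ) : ℝ) * n.factorial))
      ≤ |r| ^ (n + 1) * (((n : ℝ) + 1) ^ a * Real.Gamma (n * a + 1) /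
          (((n + 1 : ℕ) : ℝ) * n.factorial)) := by gcongr
    _ = (|r| * ((n : ℝ) + 1) ^ (a - 1)) * (|r| ^ n * (Real.Gamma (n * a + 1) / n.factorial)) := by
      rw [hsplit]; push_cast; field_simp; ring
    _ ≤ 1 / 2 * (|r| ^ n * (Real.Gamma (n * a + 1) / n.factorial)) := by
      gcongr

/-- The power series of `subordDensity`, an entire function. -/
def wrightM (a x : ℝ) : ℝ :=
  (1 / (a * Real.pi)) * ∑' n : ℕ, (-x) ^ n *
    (Real.Gamma ((n + 1 : ℝ) * a + 1) / ((n + 1).factorial : ℝ)) *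
    Real.sin ((n + 1 : ℝ) * Real.pi * a)

/-- The substitution produces x^(n+1+1/a) in the n-th term and the prefactor cancels x^(1+1/a), so
only nonnegative integer powers survive and the density extends continuously to 0. -/
theorem subordDensity_eq_wrightM {a x : ℝ} (ha : 0 < a) (hx : 0 < x) :
    subordDensity a x = wrightM a x := by
  unfold subordDensity stableDensity wrightM
  rw [← mul_assoc, ← tsum_mul_left, ← tsum_mul_left]
  refine tsum_congr fun n => ?_
  have h1 : (x ^ (-(1 / a))) ^ (-((n + 1 : ℝ) * a) - 1) = x ^ (n : ℕ) * x ^ (1 + 1 / a) := by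
    rw [← Real.rpow_mul hx.le, ← Real.rpow_natCast, ← Real.rpow_add hx]
    congr 1
    field_simp
    ring
  have h2 : x ^ (-1 - 1 / a) * x ^ (1 + 1 / a) = 1 := by
    rw [← Real.rpow_add hx]; simp
  rw [h1, neg_pow x n]
  calc _ = (1 / a * (1 / Real.pi)) * (x ^ (-1 - 1 / a) * x ^ (1 + 1 / a)) *
        ((-1) ^ n * x ^ n * (Real.Gamma ((n + 1 : ℝ) * a + 1) / ((n + 1).factorial : ℝ)) *
        Real.sin ((n + 1 : ℝ) * Real.pi * a)) := by ring
    _ = _ := by rw [h2]; field_simp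

theorem summable_wrightM_coeff {a : ℝ} (ha : 0 < a) (ha' : a < 1) {r : ℝ} (hr : 0 < r) :
    Summable fun n : ℕ => r ^ n *
      (Real.Gamma ((n + 1 : ℝ) * a + 1) / ((n + 1).factorial : ℝ)) := by
  have h := ((summable_nat_add_iff 1).2
    (summable_pow_mul_Gamma_div_factorial ha ha' r)).mul_left r⁻¹
  refine h.congr fun n => ?_
  push_cast
  rw [pow_succ]
  field_simp

theorem continuous_wrightM {a : ℝ} (ha : 0 < a) (ha' : a < 1) : Continuous (wrightM a) := by
  refine continuous_const.mul (continuous_iff_continuousAt.2 fun x => ?_)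
  have hmem : Metric.ball (0 : ℝ) (|x| + 1) ∈ 𝓝 x :=
    Metric.isOpen_ball.mem_nhds (by simp)
  refine ContinuousOn.continuousAt (continuousOn_tsum (fun n => by fun_prop)
    (summable_wrightM_coeff ha ha' (r := |x| + 1) (by positivity)) fun n y hy => ?_) hmem
  have hy' : |y| ≤ |x| + 1 := by simpa using (mem_ball_zero_iff.1 hy).le
  have hG : 0 < Real.Gamma ((n + 1 : ℝ) * a + 1) := Real.Gamma_pos_of_pos (by positivity)
  rw [norm_mul, norm_mul, norm_pow, norm_neg, Real.norm_eq_abs y, norm_div,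
    Real.norm_of_nonneg hG.le, RCLike.norm_natCast]
  calc _ ≤ (|x| + 1) ^ n * (Real.Gamma ((n + 1 : ℝ) * a + 1) / ((n + 1).factorial : ℝ)) * 1 := by
        gcongr
        exact Real.abs_sin_le_one _
    _ = _ := mul_one _

/-- The factor x allows the index to start at 0, where the sine kills the new term. In this form the
series can be matched with a termwise contour integral. -/
theorem mul_wrightM_eq_tsum {a : ℝ} (ha : 0 < a) (ha' : a < 1) {x : ℝ} (hx : 0 < x) :
    a * Real.pi * x * wrightM a x = -∑' n : ℕ, (-x) ^ n *
      (Real.Gamma (n * a + 1) / (n.factorial : ℝ)) * Real.sin (n * Real.pi * a) := by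
  have hs : Summable fun n : ℕ => (-x) ^ n *
      (Real.Gamma (n * a + 1) / (n.factorial : ℝ)) * Real.sin (n * Real.pi * a) := by
    refine Summable.of_norm_bounded (summable_pow_mul_Gamma_div_factorial ha ha' x) fun n => ?_
    have hG : 0 < Real.Gamma (n * a + 1) := Real.Gamma_pos_of_pos (by positivity)
    rw [norm_mul, norm_mul, norm_pow, norm_neg, Real.norm_of_nonneg hx.le, norm_div,
      Real.norm_of_nonneg hG.le, RCLike.norm_natCast]
    exact mul_le_of_le_one_right (by positivity) (Real.abs_sin_le_one _)
  rw [hs.tsum_eq_zero_add]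
  unfold wrightM
  have hpi := Real.pi_pos
  simp only [CharP.cast_eq_zero, zero_mul, Real.sin_zero, mul_zero, zero_add, ← tsum_neg]
  rw [← mul_assoc, ← tsum_mul_left]
  refine tsum_congr fun n => ?_
  push_cast
  rw [pow_succ]
  field_simp

/-! ### The Gamma integral along a rotated ray -/

theorem integrableOn_rpow_mul_exp_mul {s c : ℝ} (hs : 0 ≤ s) (hc : c < 0) :
    IntegrableOn (fun ρ : ℝ => ρ ^ s * Real.exp (c * ρ)) (Set.Ioi 0) := by
  simpa using integrableOn_rpow_mul_exp_neg_mul_rpow (p := 1) (s := s) (b := -c) (by linarith)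
    one_pos (by linarith)

/-- The integrand `σ ^ s e ^ σ dσ` on the ray `σ = ρ e ^ {iθ}`. -/
def rayIntegrand (s θ ρ : ℝ) : ℂ :=
  (ρ ^ s : ℝ) * Complex.exp (ρ * Complex.exp (θ * Complex.I) + θ * Complex.I * (s + 1))

theorem norm_rayIntegrand {s θ ρ : ℝ} (hρ : 0 ≤ ρ) :
    ‖rayIntegrand s θ ρ‖ = ρ ^ s * Real.exp (Real.cos θ * ρ) := by
  unfold rayIntegrand
  rw [norm_mul, Complex.norm_real, Real.norm_of_nonneg (Real.rpow_nonneg hρ _), Complex.norm_exp]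
  simp [Complex.exp_re, mul_comm]

theorem continuous_rayIntegrand {s : ℝ} (hs : 0 ≤ s) (θ : ℝ) :
    Continuous (rayIntegrand s θ) := by
  unfold rayIntegrand
  have := Real.continuous_rpow_const hs
  fun_prop

theorem integrableOn_rayIntegrand {s θ : ℝ} (hs : 0 ≤ s) (hθ : Real.cos θ < 0) :
    IntegrableOn (rayIntegrand s θ) (Set.Ioi 0) := by
  refine (integrableOn_rpow_mul_exp_mul hs hθ).mono'
    (continuous_rayIntegrand hs θ).aestronglyMeasurable ?_
  filter_upwards [ae_restrict_mem measurableSet_Ioi] with ρ hρ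
  exact (norm_rayIntegrand (le_of_lt hρ)).le

/-- The derivative of `rayIntegrand` in the angle. -/
def rayIntegrandDeriv (s θ ρ : ℝ) : ℂ :=
  Complex.I * (rayIntegrand s θ ρ * (ρ * Complex.exp (θ * Complex.I) + (s + 1)))

theorem hasDerivAt_rayIntegrand_angle (s θ ρ : ℝ) :
    HasDerivAt (fun θ : ℝ => rayIntegrand s θ ρ) (rayIntegrandDeriv s θ ρ) θ := by
  have h0 : HasDerivAt (fun θ : ℝ => (θ : ℂ) * Complex.I) Complex.I θ := by
    simpa using (Complex.ofRealCLM.hasDerivAt (x := θ)).mul_const Complex.I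
  have h := (((h0.cexp.const_mul (ρ : ℂ)).add (h0.mul_const ((s : ℂ) + 1))).cexp).const_mul
    ((ρ ^ s : ℝ) : ℂ)
  refine h.congr_deriv ?_
  simp only [rayIntegrandDeriv, rayIntegrand, Pi.add_apply]
  ring

/-- Cauchy–Riemann in polar form: up to the constant e^(iθ), the angular derivative is an exact
radial derivative. This replaces Cauchy's theorem on sectors. -/
theorem hasDerivAt_rayIntegrand_radius {s θ ρ : ℝ} (hρ : 0 < ρ) :
    HasDerivAt (fun ρ : ℝ => Complex.I * rayIntegrand (s + 1) θ ρ)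
      (rayIntegrandDeriv s θ ρ * Complex.exp (θ * Complex.I)) ρ := by
  have h0 : HasDerivAt (fun ρ : ℝ => (ρ : ℂ)) 1 ρ := Complex.ofRealCLM.hasDerivAt
  have h1 := (Real.hasDerivAt_rpow_const (x := ρ) (p := s + 1) (Or.inl hρ.ne')).ofReal_comp
  have h2 := ((h0.mul_const (Complex.exp (θ * Complex.I))).add_const
    (θ * Complex.I * ((s + 1 : ℝ) + 1))).cexp
  refine ((h1.mul h2).const_mul Complex.I).congr_deriv ?_
  have hexp : Complex.exp (ρ * Complex.exp (θ * Complex.I) + θ * Complex.I * ((s + 1 : ℝ) + 1)) =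
      Complex.exp (ρ * Complex.exp (θ * Complex.I) + θ * Complex.I * (s + 1)) *
        Complex.exp (θ * Complex.I) := by
    rw [← Complex.exp_add]; push_cast; ring_nf
  simp only [rayIntegrandDeriv, rayIntegrand]
  rw [hexp, Real.rpow_add_one hρ.ne', show s + 1 - 1 = s by ring]
  push_cast
  ring

theorem norm_rayIntegrandDeriv_le {s θ ρ c : ℝ} (hs : 0 ≤ s) (hρ : 0 < ρ) (hc : Real.cos θ ≤ c) :
    ‖rayIntegrandDeriv s θ ρ‖ ≤
      ρ ^ (s + 1) * Real.exp (c * ρ) + (s + 1) * (ρ ^ s * Real.exp (c * ρ)) := by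
  have h1 : ‖(ρ * Complex.exp (θ * Complex.I) + (s + 1) : ℂ)‖ ≤ ρ + (s + 1) := by
    refine (norm_add_le _ _).trans (add_le_add ?_ ?_)
    · rw [norm_mul, Complex.norm_exp_ofReal_mul_I, Complex.norm_real, mul_one,
        Real.norm_of_nonneg hρ.le]
    · have : (s + 1 : ℂ) = ((s + 1 : ℝ) : ℂ) := by push_cast; rfl
      rw [this, Complex.norm_real, Real.norm_of_nonneg (by linarith)]
  rw [rayIntegrandDeriv, norm_mul, Complex.norm_I, one_mul, norm_mul, norm_rayIntegrand hρ.le]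
  calc _ ≤ ρ ^ s * Real.exp (c * ρ) * (ρ + (s + 1)) := by gcongr
    _ = _ := by rw [Real.rpow_add_one hρ.ne']; ring

theorem hasDerivAt_integral_rayIntegrand {s θ : ℝ} (hs : 0 ≤ s) (hθ : Real.cos θ < 0) :
    HasDerivAt (fun θ : ℝ => ∫ ρ in Set.Ioi 0, rayIntegrand s θ ρ) 0 θ := by
  -- Half of the negative number cos θ leaves room for a dominating function valid on a
  -- neighbourhood of θ.
  set c := Real.cos θ / 2 with hc
  have hc0 : c < 0 := by linarith
  have hbound : IntegrableOn (fun ρ : ℝ => ρ ^ (s + 1) * Real.exp (c * ρ) +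
      (s + 1) * (ρ ^ s * Real.exp (c * ρ))) (Set.Ioi 0) :=
    (integrableOn_rpow_mul_exp_mul (by linarith) hc0).add
      ((integrableOn_rpow_mul_exp_mul hs hc0).const_mul _)
  have hnhds : {t : ℝ | Real.cos t < c} ∈ 𝓝 θ :=
    (isOpen_lt Real.continuous_cos continuous_const).mem_nhds (by
      show Real.cos θ < c
      linarith)
  have hcont : Continuous (rayIntegrandDeriv s θ) := by
    have := continuous_rayIntegrand hs θ
    unfold rayIntegrandDeriv
    fun_prop
  obtain ⟨hinteg, hder⟩ := hasDerivAt_integral_of_dominated_loc_of_deriv_le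
    (μ := volume.restrict (Set.Ioi (0 : ℝ))) (F := rayIntegrand s) (F' := rayIntegrandDeriv s)
    (x₀ := θ) hnhds
    (Eventually.of_forall fun t => (continuous_rayIntegrand hs t).aestronglyMeasurable)
    (integrableOn_rayIntegrand hs hθ) hcont.aestronglyMeasurable
    (by
      filter_upwards [ae_restrict_mem measurableSet_Ioi] with ρ hρ t ht
      exact norm_rayIntegrandDeriv_le hs hρ (le_of_lt ht))
    hbound (Eventually.of_forall fun ρ t _ => hasDerivAt_rayIntegrand_angle s t ρ)
  have hzero : ∫ ρ in Set.Ioi (0 : ℝ), rayIntegrandDeriv s θ ρ * Complex.exp (θ * Complex.I) =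
      0 := by
    have hlim : Tendsto (fun ρ : ℝ => Complex.I * rayIntegrand (s + 1) θ ρ) atTop (𝓝 0) := by
      rw [tendsto_zero_iff_norm_tendsto_zero]
      refine (tendsto_rpow_mul_exp_neg_mul_atTop_nhds_zero (s + 1) (-Real.cos θ)
        (by linarith)).congr' ?_
      filter_upwards [eventually_ge_atTop 0] with ρ hρ
      rw [norm_mul, Complex.norm_I, one_mul, norm_rayIntegrand hρ, neg_neg]
    rw [integral_Ioi_of_hasDerivAt_of_tendsto (m := 0)
      (((continuous_rayIntegrand (s := s + 1) (by linarith) θ).const_mul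
        Complex.I).continuousWithinAt)
      (fun ρ hρ => hasDerivAt_rayIntegrand_radius hρ) (hinteg.mul_const _) hlim]
    simp [rayIntegrand, Real.zero_rpow (by linarith : s + 1 ≠ 0)]
  rw [integral_mul_const] at hzero
  rw [(mul_eq_zero.1 hzero).resolve_right (Complex.exp_ne_zero _)] at hder
  exact hder

/-- The integral does not change while the ray turns inside the left half-plane; on the negative
axis it is Euler's integral for Γ times a phase. -/
theorem integral_rayIntegrand {s θ : ℝ} (hs : 0 ≤ s) (hθ : Real.pi / 2 < θ) (hθ' : θ < Real.pi) :
    ∫ ρ in Set.Ioi 0, rayIntegrand s θ ρ =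
      Real.Gamma (s + 1) * Complex.exp (Real.pi * Complex.I * (s + 1)) := by
  have hpi := Real.pi_pos
  have hcos : ∀ t ∈ Set.Ioo (Real.pi / 2) (Real.pi + Real.pi / 2), Real.cos t < 0 := fun t ht =>
    Real.cos_neg_of_pi_div_two_lt_of_lt ht.1 ht.2
  have hconst := isOpen_Ioo.is_const_of_deriv_eq_zero (𝕜 := ℝ)
    (f := fun θ : ℝ => ∫ ρ in Set.Ioi 0, rayIntegrand s θ ρ)
    (isPreconnected_Ioo (a := Real.pi / 2) (b := Real.pi + Real.pi / 2))
    (fun t ht => (hasDerivAt_integral_rayIntegrand hs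
      (hcos t ht)).differentiableAt.differentiableWithinAt)
    (fun t ht => (hasDerivAt_integral_rayIntegrand hs (hcos t ht)).deriv)
    (x := θ) (y := Real.pi) ⟨hθ, by linarith⟩ ⟨by linarith, by linarith⟩
  rw [hconst]
  have hG := Real.integral_rpow_mul_exp_neg_mul_Ioi (a := s + 1) (r := 1) (by linarith) one_pos
  simp only [add_sub_cancel_right, one_mul, div_one, Real.one_rpow] at hG
  rw [← hG, ← integral_complex_ofReal, ← integral_mul_const]
  refine setIntegral_congr_fun measurableSet_Ioi fun ρ _ => ?_
  simp only [rayIntegrand, Complex.exp_add, Complex.exp_pi_mul_I]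
  push_cast
  ring_nf

/-! ### The density as an integral over a shifted contour -/

/-- The point at distance `ρ` from `R` on the ray from `R` in the direction `e ^ {iθ}`. -/
def rayPoint (θ R ρ : ℝ) : ℂ := R + ρ * Complex.exp (θ * Complex.I)

theorem rayPoint_re (θ R ρ : ℝ) : (rayPoint θ R ρ).re = R + ρ * Real.cos θ := by
  simp [rayPoint, Complex.exp_re]

theorem rayPoint_im (θ R ρ : ℝ) : (rayPoint θ R ρ).im = ρ * Real.sin θ := by
  simp [rayPoint, Complex.exp_im]

theorem continuous_rayPoint (θ : ℝ) : Continuous fun p : ℝ × ℝ => rayPoint θ p.1 p.2 := by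
  unfold rayPoint; fun_prop

/-! ### Geometry of a ray starting at R ≥ 0 -/

section Bounds

variable {θ R ρ : ℝ}

theorem rayPoint_rotated (θ R ρ : ℝ) :
    (rayPoint θ R ρ).im * Real.cos θ - (rayPoint θ R ρ).re * Real.sin θ = -(R * Real.sin θ) := by
  rw [rayPoint_re, rayPoint_im]; ring

/-- R sin θ is the distance from the origin to the line carrying the ray. -/
theorem mul_sin_le_norm_rayPoint : R * Real.sin θ ≤ ‖rayPoint θ R ρ‖ := by
  rw [Complex.norm_eq_sqrt_sq_add_sq]
  refine Real.le_sqrt_of_sq_le ?_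
  rw [rayPoint_re, rayPoint_im]
  have h : (R + ρ * Real.cos θ) ^ 2 + (ρ * Real.sin θ) ^ 2 - (R * Real.sin θ) ^ 2 =
      (ρ + R * Real.cos θ) ^ 2 := by
    linear_combination (ρ ^ 2 - R ^ 2) * Real.sin_sq_add_cos_sq θ
  nlinarith [sq_nonneg (ρ + R * Real.cos θ)]

theorem rayPoint_mem_slitPlane (hs : 0 < Real.sin θ) (hρ : 0 ≤ ρ)
    (h : 0 < R ∨ 0 < ρ) : rayPoint θ R ρ ∈ Complex.slitPlane := by
  rw [Complex.mem_slitPlane_iff, rayPoint_re, rayPoint_im]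
  rcases hρ.eq_or_lt with rfl | hρ'
  · left; simpa using h
  · right; positivity

/-- An argument above θ would put the point strictly to the left of the line through 0 in direction
e^(iθ), but a shift by R ≥ 0 moves the ray to the right of it. -/
theorem arg_rayPoint_mem (hθ : 0 < θ) (hθ' : θ < Real.pi) (hR : 0 ≤ R) (hρ : 0 ≤ ρ) :
    0 ≤ (rayPoint θ R ρ).arg ∧ (rayPoint θ R ρ).arg ≤ θ := by
  have hs : 0 < Real.sin θ := Real.sin_pos_of_pos_of_lt_pi hθ hθ'
  have h0 : 0 ≤ (rayPoint θ R ρ).arg := by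
    rw [Complex.arg_nonneg_iff, rayPoint_im]; positivity
  refine ⟨h0, ?_⟩
  by_contra! hlt
  have hne : rayPoint θ R ρ ≠ 0 := by
    intro h
    rw [h, Complex.arg_zero] at hlt
    linarith
  have hn : 0 < ‖rayPoint θ R ρ‖ := norm_pos_iff.2 hne
  have hsin : 0 < Real.sin ((rayPoint θ R ρ).arg - θ) :=
    Real.sin_pos_of_pos_of_lt_pi (by linarith) (by linarith [Complex.arg_le_pi (rayPoint θ R ρ)])
  have h := rayPoint_rotated θ R ρ
  rw [← Complex.norm_mul_cos_arg, ← Complex.norm_mul_sin_arg] at h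
  rw [Real.sin_sub] at hsin
  have := mul_pos hn hsin
  nlinarith [mul_nonneg hR hs.le]

/-- The argument of σ^a stays in [0, aθ], inside the right half-plane. This is the source of the
decay in x. -/
theorem cos_mul_norm_rpow_le_re_cpow {a : ℝ} (ha : 0 < a) (hθ : 0 < θ) (hθ' : θ < Real.pi)
    (haθ : a * θ < Real.pi / 2) (hR : 0 ≤ R) (hρ : 0 ≤ ρ) :
    Real.cos (a * θ) * ‖rayPoint θ R ρ‖ ^ a ≤ (rayPoint θ R ρ ^ (a : ℂ)).re := by
  obtain ⟨h0, h1⟩ := arg_rayPoint_mem hθ hθ' hR hρ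
  rw [Complex.cpow_ofReal_re, mul_comm]
  have hpi := Real.pi_pos
  gcongr
  rw [mul_comm a θ]
  exact Real.cos_le_cos_of_nonneg_of_le_pi (by positivity) (by nlinarith) (by gcongr)

end Bounds

/-- The function `e ^ (σ - x σ ^ a)` at the point `σ = R + ρ e ^ {iθ}`. -/
def contourFun (a x θ R ρ : ℝ) : ℂ :=
  Complex.exp (rayPoint θ R ρ - x * rayPoint θ R ρ ^ (a : ℂ))

/-- The factor `1 - a x σ ^ (a - 1)` in the derivative of `contourFun`. -/
def contourFactor (a x θ R ρ : ℝ) : ℂ :=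
  1 - x * (a * rayPoint θ R ρ ^ ((a : ℂ) - 1))

/-- The integral of `e ^ (σ - x σ ^ a) dσ` over the ray from `R` in the direction `e ^ {iθ}`. -/
def contourIntegral (a x θ R : ℝ) : ℂ :=
  ∫ ρ in Set.Ioi 0, contourFun a x θ R ρ * Complex.exp (θ * Complex.I)

/-! ### Shifting the contour and expanding at R = 0 -/

section Contour

variable {a x θ : ℝ}

/-- Two separate gains: Re σ gives integrability in ρ, while Re σ^a gives decay in x at a rate
uniform in ρ and as large as desired when R grows. -/
theorem norm_contourFun_le (ha : 0 < a) (hx : 0 ≤ x) (hθ : Real.pi / 2 < θ) (hθ' : θ < Real.pi)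
    (haθ : a * θ < Real.pi / 2) {R ρ : ℝ} (hR : 0 ≤ R) (hρ : 0 ≤ ρ) :
    ‖contourFun a x θ R ρ‖ ≤ Real.exp (R - x * (Real.cos (a * θ) * (R * Real.sin θ) ^ a)) *
      Real.exp (Real.cos θ * ρ) := by
  have hpi := Real.pi_pos
  have hθ0 : 0 < θ := by linarith
  have hs : 0 < Real.sin θ := Real.sin_pos_of_pos_of_lt_pi hθ0 hθ'
  have hc : 0 < Real.cos (a * θ) := Real.cos_pos_of_mem_Ioo ⟨by nlinarith, haθ⟩
  have h1 := cos_mul_norm_rpow_le_re_cpow ha hθ0 hθ' haθ hR hρ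
  have h2 : (R * Real.sin θ) ^ a ≤ ‖rayPoint θ R ρ‖ ^ a :=
    Real.rpow_le_rpow (by positivity) mul_sin_le_norm_rayPoint ha.le
  have h3 : Real.cos (a * θ) * (R * Real.sin θ) ^ a ≤ (rayPoint θ R ρ ^ (a : ℂ)).re :=
    (mul_le_mul_of_nonneg_left h2 hc.le).trans h1
  rw [contourFun, Complex.norm_exp, ← Real.exp_add, Complex.sub_re, Complex.re_ofReal_mul,
    rayPoint_re, Real.exp_le_exp]
  linarith [mul_le_mul_of_nonneg_left h3 hx, mul_comm ρ (Real.cos θ)]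

theorem continuousAt_contourFun (hθ : 0 < θ) (hθ' : θ < Real.pi) {R ρ : ℝ}
    (hρ : 0 ≤ ρ) (h : 0 < R ∨ 0 < ρ) :
    ContinuousAt (fun p : ℝ × ℝ => contourFun a x θ p.1 p.2) (R, ρ) := by
  have hmem := rayPoint_mem_slitPlane (Real.sin_pos_of_pos_of_lt_pi hθ hθ') hρ h
  have hc := (continuous_rayPoint θ).continuousAt (x := (R, ρ))
  unfold contourFun
  exact (hc.sub (continuousAt_const.mul (hc.cpow continuousAt_const hmem))).cexp

theorem hasDerivAt_exp_sub_mul_cpow {γ : ℝ → ℂ} {γ' : ℂ} {t : ℝ} (hγ : HasDerivAt γ γ' t)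
    (hmem : γ t ∈ Complex.slitPlane) :
    HasDerivAt (fun t => Complex.exp (γ t - x * γ t ^ (a : ℂ)))
      (Complex.exp (γ t - x * γ t ^ (a : ℂ)) * (1 - x * (a * γ t ^ ((a : ℂ) - 1))) * γ') t := by
  have hpow : HasDerivAt (fun t => γ t ^ (a : ℂ)) (a * γ t ^ ((a : ℂ) - 1) * γ') t :=
    (((hasDerivAt_id (γ t)).cpow_const (c := (a : ℂ)) hmem).comp t hγ).congr_deriv (by simp)
  exact (hγ.sub (hpow.const_mul (x : ℂ))).cexp.congr_deriv (by simp only [Pi.sub_apply]; ring)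

theorem hasDerivAt_contourFun_shift {R ρ : ℝ} (hmem : rayPoint θ R ρ ∈ Complex.slitPlane) :
    HasDerivAt (fun R => contourFun a x θ R ρ)
      (contourFun a x θ R ρ * contourFactor a x θ R ρ) R := by
  have h : HasDerivAt (fun R => rayPoint θ R ρ) 1 R := by
    unfold rayPoint
    exact (Complex.ofRealCLM.hasDerivAt (x := R)).add_const _
  exact (hasDerivAt_exp_sub_mul_cpow h hmem).congr_deriv (mul_one _)

theorem hasDerivAt_contourFun_radius {R ρ : ℝ} (hmem : rayPoint θ R ρ ∈ Complex.slitPlane) :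
    HasDerivAt (fun ρ => contourFun a x θ R ρ)
      (contourFun a x θ R ρ * contourFactor a x θ R ρ * Complex.exp (θ * Complex.I)) ρ := by
  have h : HasDerivAt (fun ρ => rayPoint θ R ρ) (Complex.exp (θ * Complex.I)) ρ := by
    unfold rayPoint
    exact (((Complex.ofRealCLM.hasDerivAt (x := ρ)).mul_const _).const_add _).congr_deriv (by simp)
  exact hasDerivAt_exp_sub_mul_cpow h hmem

theorem norm_contourFactor_le (ha : 0 < a) (ha' : a < 1) (hx : 0 ≤ x) (hs : 0 < Real.sin θ)
    {r R ρ : ℝ} (hr : 0 < r) (hR : r ≤ R) :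
    ‖contourFactor a x θ R ρ‖ ≤ 1 + x * (a * (r * Real.sin θ) ^ (a - 1)) := by
  have h1 : r * Real.sin θ ≤ ‖rayPoint θ R ρ‖ :=
    (mul_le_mul_of_nonneg_right hR hs.le).trans mul_sin_le_norm_rayPoint
  have h2 : ‖rayPoint θ R ρ‖ ^ (a - 1) ≤ (r * Real.sin θ) ^ (a - 1) :=
    Real.rpow_le_rpow_of_nonpos (by positivity) h1 (by linarith)
  have h3 : ((a : ℂ) - 1) = ((a - 1 : ℝ) : ℂ) := by push_cast; rfl
  unfold contourFactor
  refine (norm_sub_le _ _).trans ?_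
  rw [norm_one, norm_mul, norm_mul, h3, Complex.norm_cpow_real, Complex.norm_real,
    Complex.norm_real, Real.norm_of_nonneg ha.le, Real.norm_of_nonneg hx]
  gcongr

theorem continuousOn_contourFun (hθ : 0 < θ) (hθ' : θ < Real.pi) (R : ℝ) :
    ContinuousOn (contourFun a x θ R) (Set.Ioi 0) := fun ρ hρ =>
  ((continuousAt_contourFun hθ hθ' (le_of_lt hρ) (Or.inr hρ)).comp (f := fun ρ => (R, ρ))
    (by fun_prop)).continuousWithinAt

theorem continuousOn_contourFactor (hθ : 0 < θ) (hθ' : θ < Real.pi) (R : ℝ) :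
    ContinuousOn (contourFactor a x θ R) (Set.Ioi 0) := fun ρ hρ => by
  have hmem := rayPoint_mem_slitPlane (R := R) (Real.sin_pos_of_pos_of_lt_pi hθ hθ') (le_of_lt hρ)
    (Or.inr hρ)
  have hc : ContinuousAt (rayPoint θ R) ρ :=
    ((continuous_rayPoint θ).comp (f := fun ρ => (R, ρ)) (by fun_prop)).continuousAt
  exact (continuousAt_const.sub (continuousAt_const.mul (continuousAt_const.mul
    (hc.cpow continuousAt_const hmem)))).continuousWithinAt

theorem aestronglyMeasurable_contourFun (hθ : 0 < θ) (hθ' : θ < Real.pi) (R : ℝ) :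
    AEStronglyMeasurable (contourFun a x θ R) (volume.restrict (Set.Ioi 0)) :=
  (continuousOn_contourFun hθ hθ' R).aestronglyMeasurable measurableSet_Ioi

theorem integrableOn_contourFun (ha : 0 < a) (hx : 0 ≤ x) (hθ : Real.pi / 2 < θ)
    (hθ' : θ < Real.pi) (haθ : a * θ < Real.pi / 2) {R : ℝ} (hR : 0 ≤ R) :
    IntegrableOn (contourFun a x θ R) (Set.Ioi 0) := by
  have hpi := Real.pi_pos
  have hcos : Real.cos θ < 0 := Real.cos_neg_of_pi_div_two_lt_of_lt hθ (by linarith)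
  refine ((integrableOn_exp_mul_Ioi hcos 0).const_mul
    (Real.exp (R - x * (Real.cos (a * θ) * (R * Real.sin θ) ^ a)))).mono'
    (aestronglyMeasurable_contourFun (by linarith) hθ' R) ?_
  filter_upwards [ae_restrict_mem measurableSet_Ioi] with ρ hρ
  exact norm_contourFun_le ha hx hθ hθ' haθ hR (le_of_lt hρ)

/-- The derivatives in R and in ρ differ only by the factor e^(iθ), so differentiating under the
integral leaves an exact radial derivative and only the endpoint ρ = 0 contributes. -/
theorem hasDerivAt_contourIntegral (ha : 0 < a) (ha' : a < 1) (hx : 0 ≤ x)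
    (hθ : Real.pi / 2 < θ) (hθ' : θ < Real.pi) (haθ : a * θ < Real.pi / 2) {R : ℝ} (hR : 0 < R) :
    HasDerivAt (contourIntegral a x θ) (-contourFun a x θ R 0) R := by
  have hpi := Real.pi_pos
  have hθ0 : 0 < θ := by linarith
  have hs : 0 < Real.sin θ := Real.sin_pos_of_pos_of_lt_pi hθ0 hθ'
  have hcos : Real.cos θ < 0 := Real.cos_neg_of_pi_div_two_lt_of_lt hθ (by linarith)
  have hc : 0 < Real.cos (a * θ) := Real.cos_pos_of_mem_Ioo ⟨by nlinarith, haθ⟩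
  have hnhds : Set.Ioo (R / 2) (2 * R) ∈ 𝓝 R := Ioo_mem_nhds (by linarith) (by linarith)
  have hexp : ‖Complex.exp (θ * Complex.I)‖ = 1 := Complex.norm_exp_ofReal_mul_I θ
  obtain ⟨hinteg, hder⟩ := hasDerivAt_integral_of_dominated_loc_of_deriv_le
    (μ := volume.restrict (Set.Ioi (0 : ℝ)))
    (F := fun R ρ => contourFun a x θ R ρ * Complex.exp (θ * Complex.I))
    (F' := fun R ρ => contourFun a x θ R ρ * contourFactor a x θ R ρ * Complex.exp (θ * Complex.I))
    (bound := fun ρ => (Real.exp (2 * R) * (1 + x * (a * (R / 2 * Real.sin θ) ^ (a - 1)))) *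
      Real.exp (Real.cos θ * ρ))
    (x₀ := R) hnhds
    (Eventually.of_forall fun r => (aestronglyMeasurable_contourFun hθ0 hθ' r).mul_const _)
    ((integrableOn_contourFun ha hx hθ hθ' haθ hR.le).mul_const _)
    ((((continuousOn_contourFun hθ0 hθ' R).mul
      (continuousOn_contourFactor hθ0 hθ' R)).mul continuousOn_const).aestronglyMeasurable
        measurableSet_Ioi)
    (by
      filter_upwards [ae_restrict_mem measurableSet_Ioi] with ρ hρ r hr
      have hr0 : 0 ≤ r := by linarith [hr.1]
      have h1 := norm_contourFun_le ha hx hθ hθ' haθ hr0 (le_of_lt hρ)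
      have h2 := norm_contourFactor_le (ρ := ρ) ha ha' hx hs (half_pos hR) hr.1.le
      have h3 : Real.exp (r - x * (Real.cos (a * θ) * (r * Real.sin θ) ^ a)) ≤
          Real.exp (2 * R) := by
        have : 0 ≤ x * (Real.cos (a * θ) * (r * Real.sin θ) ^ a) := by positivity
        exact Real.exp_le_exp.2 (by linarith [hr.2])
      rw [norm_mul, norm_mul, hexp, mul_one]
      calc _ ≤ (Real.exp (2 * R) * Real.exp (Real.cos θ * ρ)) *
            (1 + x * (a * (R / 2 * Real.sin θ) ^ (a - 1))) := by
            gcongr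
            exact h1.trans (by gcongr)
        _ = _ := by ring)
    ((integrableOn_exp_mul_Ioi hcos 0).const_mul _)
    (by
      filter_upwards [ae_restrict_mem measurableSet_Ioi] with ρ hρ r hr
      exact (hasDerivAt_contourFun_shift (rayPoint_mem_slitPlane hs
        (le_of_lt hρ) (Or.inr hρ))).mul_const _)
  have hlim : Tendsto (contourFun a x θ R) atTop (𝓝 0) := by
    refine squeeze_zero_norm' (a := fun ρ =>
      Real.exp (R - x * (Real.cos (a * θ) * (R * Real.sin θ) ^ a)) *
        Real.exp (Real.cos θ * ρ)) ?_ ?_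
    · filter_upwards [eventually_ge_atTop 0] with ρ hρ
      exact norm_contourFun_le ha hx hθ hθ' haθ hR.le hρ
    · have h1 : Tendsto (fun ρ : ℝ => Real.exp (Real.cos θ * ρ)) atTop (𝓝 0) :=
        Real.tendsto_exp_atBot.comp (tendsto_id.const_mul_atTop_of_neg hcos)
      simpa using h1.const_mul _
  have hval := integral_Ioi_of_hasDerivAt_of_tendsto (a := 0) (f := contourFun a x θ R)
    ((continuousAt_contourFun hθ0 hθ' le_rfl (Or.inl hR)).comp (f := fun ρ => (R, ρ))
      (by fun_prop)).continuousWithinAt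
    (fun ρ hρ => hasDerivAt_contourFun_radius (rayPoint_mem_slitPlane hs (le_of_lt hρ)
      (Or.inr hρ))) hinteg hlim
  rw [zero_sub] at hval
  rw [hval] at hder
  exact hder

theorem contourFun_zero_im {R : ℝ} (hR : 0 ≤ R) : (contourFun a x θ R 0).im = 0 := by
  have : rayPoint θ R 0 - x * rayPoint θ R 0 ^ (a : ℂ) = ((R - x * R ^ a : ℝ) : ℂ) := by
    simp only [rayPoint]
    push_cast
    rw [Complex.ofReal_cpow hR]
    simp
  rw [contourFun, this, ← Complex.ofReal_exp, Complex.ofReal_im]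

/-- The endpoint contribution is real, so the imaginary part is constant for R > 0. The value at R =
0, where the ray starts at the branch point, is reached by dominated convergence. -/
theorem contourIntegral_im_eq (ha : 0 < a) (ha' : a < 1) (hx : 0 ≤ x)
    (hθ : Real.pi / 2 < θ) (hθ' : θ < Real.pi) (haθ : a * θ < Real.pi / 2) {R : ℝ} (hR : 0 < R) :
    (contourIntegral a x θ R).im = (contourIntegral a x θ 0).im := by
  have hpi := Real.pi_pos
  have hθ0 : 0 < θ := by linarith
  have hs : 0 < Real.sin θ := Real.sin_pos_of_pos_of_lt_pi hθ0 hθ'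
  have hcos : Real.cos θ < 0 := Real.cos_neg_of_pi_div_two_lt_of_lt hθ (by linarith)
  have hc : 0 < Real.cos (a * θ) := Real.cos_pos_of_mem_Ioo ⟨by nlinarith, haθ⟩
  have hder : ∀ r : ℝ, 0 < r → HasDerivAt (fun r => (contourIntegral a x θ r).im) 0 r := by
    intro r hr
    have h := Complex.imCLM.hasFDerivAt.comp_hasDerivAt r
      (hasDerivAt_contourIntegral ha ha' hx hθ hθ' haθ hr)
    refine h.congr_deriv ?_
    simp [contourFun_zero_im hr.le]
  have hconst : ∀ r : ℝ, 0 < r → (contourIntegral a x θ r).im = (contourIntegral a x θ R).im :=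
    fun r hr => isOpen_Ioi.is_const_of_deriv_eq_zero (𝕜 := ℝ) isPreconnected_Ioi
      (fun t ht => (hder t ht).differentiableAt.differentiableWithinAt)
      (fun t ht => (hder t ht).deriv) (Set.mem_Ioi.2 hr) (Set.mem_Ioi.2 hR)
  have hcont : ContinuousWithinAt (contourIntegral a x θ) (Set.Ioi 0) 0 := by
    refine continuousWithinAt_of_dominated
      (bound := fun ρ => Real.exp 1 * Real.exp (Real.cos θ * ρ)) ?_ ?_
      ((integrableOn_exp_mul_Ioi hcos 0).const_mul _) ?_
    · exact Eventually.of_forall fun r =>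
        (aestronglyMeasurable_contourFun hθ0 hθ' r).mul_const _
    · filter_upwards [self_mem_nhdsWithin,
        mem_nhdsWithin_of_mem_nhds (Iio_mem_nhds (zero_lt_one (α := ℝ)))] with r hr hr1
      filter_upwards [ae_restrict_mem measurableSet_Ioi] with ρ hρ
      have hr' : 0 < r := hr
      rw [norm_mul, Complex.norm_exp_ofReal_mul_I, mul_one]
      refine (norm_contourFun_le ha hx hθ hθ' haθ hr'.le (le_of_lt hρ)).trans ?_
      have : 0 ≤ x * (Real.cos (a * θ) * (r * Real.sin θ) ^ a) := by positivity
      have hr1' : r < 1 := hr1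
      gcongr
      linarith
    · filter_upwards [ae_restrict_mem measurableSet_Ioi] with ρ hρ
      exact (((continuousAt_contourFun hθ0 hθ' (le_of_lt hρ) (Or.inr hρ)).comp
        (f := fun r => (r, ρ)) (by fun_prop)).mul continuousAt_const).continuousWithinAt
  have h1 : Tendsto (fun r => (contourIntegral a x θ r).im) (𝓝[>] 0)
      (𝓝 (contourIntegral a x θ 0).im) :=
    (Complex.continuous_im.tendsto _).comp hcont
  have h2 : Tendsto (fun r => (contourIntegral a x θ r).im) (𝓝[>] 0)
      (𝓝 (contourIntegral a x θ R).im) :=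
    tendsto_const_nhds.congr' (by
      filter_upwards [self_mem_nhdsWithin] with r hr
      exact (hconst r hr).symm)
  exact tendsto_nhds_unique h2 h1

theorem rayPoint_zero_cpow {ρ : ℝ} (hθ : 0 < θ) (hθ' : θ < Real.pi) (hρ : 0 < ρ) :
    rayPoint θ 0 ρ ^ (a : ℂ) = (ρ ^ a : ℝ) * Complex.exp (θ * Complex.I * a) := by
  have hpt : rayPoint θ 0 ρ = ρ * Complex.exp (θ * Complex.I) := by simp [rayPoint]
  have hne : rayPoint θ 0 ρ ≠ 0 := by
    rw [hpt]
    exact mul_ne_zero (by exact_mod_cast hρ.ne') (Complex.exp_ne_zero _)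
  rw [Complex.cpow_def_of_ne_zero hne, hpt, Complex.log_ofReal_mul hρ (Complex.exp_ne_zero _),
    Complex.log_exp (by simp; linarith) (by simp; linarith), add_mul, Complex.exp_add,
    Real.rpow_def_of_pos hρ]
  push_cast
  rfl

/-- Expand e^(-xσ^a) and integrate term by term, each term being a rotated Gamma integral. The
integrals of the norms form the Gamma series at radius x (-1/cos θ)^a, which still converges. -/
theorem hasSum_contourIntegral_zero (ha : 0 < a) (ha' : a < 1) (hx : 0 ≤ x)
    (hθ : Real.pi / 2 < θ) (hθ' : θ < Real.pi) :
    HasSum (fun n : ℕ => (((-x) ^ n / (n.factorial : ℝ) : ℝ) : ℂ) *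
      (Real.Gamma (n * a + 1) * Complex.exp (Real.pi * Complex.I * ((n * a : ℝ) + 1))))
      (contourIntegral a x θ 0) := by
  have hpi := Real.pi_pos
  have hcos : Real.cos θ < 0 := Real.cos_neg_of_pi_div_two_lt_of_lt hθ (by linarith)
  have hnorm : ∀ (n : ℕ), ∀ ρ ∈ Set.Ioi (0 : ℝ),
      ‖(((-x) ^ n / (n.factorial : ℝ) : ℝ) : ℂ) * rayIntegrand (n * a) θ ρ‖ =
        x ^ n / n.factorial * (ρ ^ ((n * a + 1) - 1) * Real.exp (-(-Real.cos θ * ρ))) := by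
    intro n ρ hρ
    rw [norm_mul, norm_rayIntegrand (le_of_lt hρ), Complex.norm_real, norm_div, norm_pow, norm_neg,
      Real.norm_of_nonneg hx, RCLike.norm_natCast, add_sub_cancel_right, neg_mul, neg_neg]
  have h := hasSum_integral_of_summable_integral_norm (μ := volume.restrict (Set.Ioi (0 : ℝ)))
    (F := fun (n : ℕ) ρ => (((-x) ^ n / (n.factorial : ℝ) : ℝ) : ℂ) * rayIntegrand (n * a) θ ρ)
    (fun n => (integrableOn_rayIntegrand (by positivity) hcos).const_mul _)
    (by
      have hs := (summable_pow_mul_Gamma_div_factorial ha ha'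
        (x * (1 / -Real.cos θ) ^ a)).mul_left (1 / -Real.cos θ)
      refine hs.congr fun n => ?_
      rw [setIntegral_congr_fun measurableSet_Ioi (hnorm n), integral_const_mul,
        Real.integral_rpow_mul_exp_neg_mul_Ioi (by positivity) (by linarith)]
      have hb : 0 < 1 / -Real.cos θ := one_div_pos.2 (by linarith)
      rw [Real.rpow_add_one hb.ne', mul_comm (n : ℝ) a, Real.rpow_mul hb.le, Real.rpow_natCast,
        mul_pow]
      ring)
  have hval : ∫ ρ in Set.Ioi (0 : ℝ), ∑' n : ℕ,
      (((-x) ^ n / (n.factorial : ℝ) : ℝ) : ℂ) * rayIntegrand (n * a) θ ρ =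
        contourIntegral a x θ 0 := by
    refine setIntegral_congr_fun measurableSet_Ioi fun ρ hρ => ?_
    have hρ0 : 0 < ρ := hρ
    have hexp := (NormedSpace.expSeries_div_hasSum_exp
      (-(x * rayPoint θ 0 ρ ^ (a : ℂ)) : ℂ))
    rw [← Complex.exp_eq_exp_ℂ] at hexp
    have h2 := hexp.mul_left (Complex.exp (rayPoint θ 0 ρ) * Complex.exp (θ * Complex.I))
    have h3 : contourFun a x θ 0 ρ * Complex.exp (θ * Complex.I) =
        Complex.exp (rayPoint θ 0 ρ) * Complex.exp (θ * Complex.I) *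
          Complex.exp (-(x * rayPoint θ 0 ρ ^ (a : ℂ))) := by
      rw [contourFun, sub_eq_add_neg, Complex.exp_add]; ring
    show _ = contourFun a x θ 0 ρ * Complex.exp (θ * Complex.I)
    rw [h3, ← h2.tsum_eq]
    refine tsum_congr fun n => ?_
    rw [rayPoint_zero_cpow (by linarith) hθ' hρ0, rayIntegrand, neg_pow (_ * _), mul_pow, mul_pow,
      ← Complex.exp_nat_mul, Complex.exp_add,
      mul_comm (n : ℝ) a, Real.rpow_mul hρ0.le, Real.rpow_natCast,
      show (θ * Complex.I * ((a * (n : ℝ) : ℝ) + 1) : ℂ) = n * (θ * Complex.I * a) + θ * Complex.I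
        by push_cast; ring, Complex.exp_add, neg_pow x n,
      show rayPoint θ 0 ρ = ρ * Complex.exp (θ * Complex.I) by simp [rayPoint]]
    push_cast
    ring
  rw [hval] at h
  have hterm : ∀ n : ℕ, ∫ ρ in Set.Ioi (0 : ℝ),
      (((-x) ^ n / (n.factorial : ℝ) : ℝ) : ℂ) * rayIntegrand (n * a) θ ρ =
        (((-x) ^ n / (n.factorial : ℝ) : ℝ) : ℂ) *
      (Real.Gamma (n * a + 1) * Complex.exp (Real.pi * Complex.I * ((n * a : ℝ) + 1))) :=
    fun n => by rw [integral_const_mul, integral_rayIntegrand (by positivity) hθ hθ']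
  simpa only [hterm] using h

theorem mul_wrightM_eq_contourIntegral_im (ha : 0 < a) (ha' : a < 1) (hx : 0 < x)
    (hθ : Real.pi / 2 < θ) (hθ' : θ < Real.pi) :
    a * Real.pi * x * wrightM a x = (contourIntegral a x θ 0).im := by
  have h := Complex.imCLM.hasSum (hasSum_contourIntegral_zero ha ha' hx.le hθ hθ')
  rw [mul_wrightM_eq_tsum ha ha' hx, ← tsum_neg]
  refine Eq.trans (tsum_congr fun n => ?_) h.tsum_eq
  have hexp : Complex.exp (Real.pi * Complex.I * ((n * a : ℝ) + 1)) =
      -Complex.exp ((n * Real.pi * a : ℝ) * Complex.I) := by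
    rw [mul_add, mul_one, Complex.exp_add, Complex.exp_pi_mul_I]
    push_cast
    ring_nf
  rw [hexp]
  simp only [Complex.imCLM_apply]
  rw [Complex.im_ofReal_mul, Complex.im_ofReal_mul, Complex.neg_im, Complex.exp_ofReal_mul_I_im]
  ring

end Contour

/-- The ray must lean past the imaginary axis so that e^σ decays, while σ^a must stay in the right
half-plane; a < 1 leaves room for both. -/
theorem exists_angle {a : ℝ} (ha : 0 < a) (ha' : a < 1) :
    ∃ θ : ℝ, Real.pi / 2 < θ ∧ θ < Real.pi ∧ a * θ < Real.pi / 2 := by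
  have hpi := Real.pi_pos
  have hlt : Real.pi / 2 < min Real.pi (Real.pi / 2 / a) := by
    rw [lt_min_iff, lt_div_iff₀ ha]
    constructor <;> nlinarith
  obtain ⟨θ, h1, h2⟩ := exists_between hlt
  rw [lt_min_iff, lt_div_iff₀ ha] at h2
  exact ⟨θ, h1, h2.1, by linarith [h2.2]⟩

/-- The density decays faster than every exponential. -/
theorem exists_abs_wrightM_le {a : ℝ} (ha : 0 < a) (ha' : a < 1) (K : ℝ) :
    ∃ C : ℝ, 0 < C ∧ ∀ x : ℝ, 0 ≤ x → |wrightM a x| ≤ C * Real.exp (-K * x) := by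
  obtain ⟨θ, hθ, hθ', haθ⟩ := exists_angle ha ha'
  have hpi := Real.pi_pos
  have hθ0 : 0 < θ := by linarith
  have hs : 0 < Real.sin θ := Real.sin_pos_of_pos_of_lt_pi hθ0 hθ'
  have hcos : Real.cos θ < 0 := Real.cos_neg_of_pi_div_two_lt_of_lt hθ (by linarith)
  have hc : 0 < Real.cos (a * θ) := Real.cos_pos_of_mem_Ioo ⟨by nlinarith, haθ⟩
  -- The contour identity carries a factor x and is useful only for x ≥ 1; on [0,1] continuity
  -- suffices.
  obtain ⟨D, hD⟩ := isCompact_Icc.exists_bound_of_continuousOn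
    (f := fun x => wrightM a x * Real.exp (K * x)) (s := Set.Icc (0 : ℝ) 1)
    ((continuous_wrightM ha ha').mul (by fun_prop)).continuousOn
  -- k and R are solved from cos(aθ) (R sin θ)^a ≥ K; the added 1 keeps R positive when K ≤ 0.
  set k : ℝ := max K 0 / Real.cos (a * θ) with hk
  have hk0 : 0 ≤ k := by positivity
  set R : ℝ := k ^ (1 / a) / Real.sin θ + 1 with hR
  have hR0 : 0 < R := by positivity
  have hRK : K ≤ Real.cos (a * θ) * (R * Real.sin θ) ^ a := by
    have h1 : k ^ (1 / a) ≤ R * Real.sin θ := by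
      rw [hR, add_mul, div_mul_cancel₀ _ hs.ne']
      linarith
    have h2 : k ≤ (R * Real.sin θ) ^ a := by
      have := Real.rpow_le_rpow (by positivity) h1 ha.le
      rwa [← Real.rpow_mul hk0, one_div_mul_cancel ha.ne', Real.rpow_one] at this
    calc K ≤ max K 0 := le_max_left _ _
      _ = Real.cos (a * θ) * k := by rw [hk]; field_simp
      _ ≤ _ := by gcongr
  set I : ℝ := ∫ ρ in Set.Ioi (0 : ℝ), Real.exp (Real.cos θ * ρ) with hI
  have hI0 : 0 ≤ I := integral_nonneg fun ρ => (Real.exp_pos _).le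
  refine ⟨|D| + Real.exp R * I / (a * Real.pi) + 1, by positivity, fun x hx => ?_⟩
  rcases le_total x 1 with hx1 | hx1
  · have h := hD x ⟨hx, hx1⟩
    rw [norm_mul, Real.norm_eq_abs, Real.norm_eq_abs, Real.abs_exp] at h
    have h2 : |wrightM a x| ≤ |D| * Real.exp (-K * x) := by
      rw [neg_mul, Real.exp_neg, ← div_eq_mul_inv, le_div_iff₀ (Real.exp_pos _)]
      exact h.trans (le_abs_self D)
    refine h2.trans ?_
    gcongr
    have : 0 ≤ Real.exp R * I / (a * Real.pi) := by positivity
    linarith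
  · have hx0 : 0 < x := by linarith
    have h1 := mul_wrightM_eq_contourIntegral_im ha ha' hx0 hθ hθ'
    rw [← contourIntegral_im_eq ha ha' hx hθ hθ' haθ hR0] at h1
    have h2 : ‖contourIntegral a x θ R‖ ≤ Real.exp R * Real.exp (-K * x) * I := by
      rw [hI, ← integral_const_mul]
      refine norm_integral_le_of_norm_le ((integrableOn_exp_mul_Ioi hcos 0).const_mul _) ?_
      filter_upwards [ae_restrict_mem measurableSet_Ioi] with ρ hρ
      rw [norm_mul, Complex.norm_exp_ofReal_mul_I, mul_one]
      refine (norm_contourFun_le ha hx hθ hθ' haθ hR0.le (le_of_lt hρ)).trans ?_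
      rw [← Real.exp_add R]
      gcongr
      linarith [mul_le_mul_of_nonneg_left hRK hx]
    have h3 : a * Real.pi * |wrightM a x| ≤ Real.exp R * Real.exp (-K * x) * I := by
      calc a * Real.pi * |wrightM a x| ≤ a * Real.pi * x * |wrightM a x| := by
            refine mul_le_mul_of_nonneg_right ?_ (abs_nonneg _)
            exact le_mul_of_one_le_right (by positivity) hx1
        _ = |(contourIntegral a x θ R).im| := by
            rw [← h1, abs_mul, abs_of_pos (by positivity : 0 < a * Real.pi * x)]
        _ ≤ _ := (Complex.abs_im_le_norm _).trans h2
    have h4 : |wrightM a x| ≤ Real.exp R * I / (a * Real.pi) * Real.exp (-K * x) := by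
      rw [div_mul_eq_mul_div, le_div_iff₀ (by positivity)]
      linarith
    refine h4.trans ?_
    gcongr
    linarith [abs_nonneg D]

/-! ### `C₀`-semigroups: growth bound and strong continuity -/

namespace IsC0Semigroup

variable {X : Type*} [NormedAddCommGroup X] [NormedSpace ℝ X] {S : ℝ → X →L[ℝ] X}

theorem tendsto_nhdsGE_zero (hS : IsC0Semigroup S) (x : X) :
    Tendsto (fun t => S t x) (𝓝[≥] 0) (𝓝 x) := by
  rw [← Set.Ioi_insert, nhdsWithin_insert, tendsto_sup]
  refine ⟨?_, hS.tendsto_zero x⟩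
  have h : S 0 x = x := by rw [hS.map_zero]; rfl
  simpa [h] using tendsto_pure_nhds (fun t => S t x) 0

/-- Otherwise some t_n → 0 has ‖S(t_n)‖ unbounded, although S(t_n)x converges for each x, against
Banach–Steinhaus. -/
theorem exists_norm_le_near_zero [CompleteSpace X] (hS : IsC0Semigroup S) :
    ∃ δ C : ℝ, 0 < δ ∧ 1 ≤ C ∧ ∀ t, 0 ≤ t → t ≤ δ → ‖S t‖ ≤ C := by
  by_contra! hcon
  have hseq : ∀ n : ℕ, ∃ t : ℝ, 0 ≤ t ∧ t ≤ 1 / ((n : ℝ) + 1) ∧ (n : ℝ) + 1 < ‖S t‖ := fun n =>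
    hcon (1 / ((n : ℝ) + 1)) ((n : ℝ) + 1) (by positivity) (by simp)
  choose t ht0 ht1 htn using hseq
  have hlim : Tendsto t atTop (𝓝[≥] 0) := by
    refine tendsto_nhdsWithin_iff.2 ⟨?_, Eventually.of_forall ht0⟩
    exact squeeze_zero ht0 ht1 tendsto_one_div_add_atTop_nhds_zero_nat
  obtain ⟨C, hC⟩ := banach_steinhaus (g := fun n => S (t n)) fun x => by
    obtain ⟨D, hD⟩ := (((hS.tendsto_nhdsGE_zero x).comp hlim).norm).bddAbove_range
    exact ⟨D, fun n => hD ⟨n, rfl⟩⟩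
  obtain ⟨n, hn⟩ := exists_nat_gt C
  linarith [hC n, htn n]

/-- Exponential growth bound of a `C₀`-semigroup. -/
theorem exists_norm_le_exp [CompleteSpace X] (hS : IsC0Semigroup S) :
    ∃ M ω : ℝ, 0 < M ∧ 0 ≤ ω ∧ ∀ t, 0 ≤ t → ‖S t‖ ≤ M * Real.exp (ω * t) := by
  obtain ⟨δ, C, hδ, hC, hbound⟩ := hS.exists_norm_le_near_zero
  have hC0 : 0 < C := by linarith
  have hstep : ∀ n : ℕ, ∀ t : ℝ, 0 ≤ t → t ≤ (n + 1) * δ → ‖S t‖ ≤ C ^ (n + 1) := by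
    intro n
    induction n with
    | zero => intro t ht ht'; simpa using hbound t ht (by simpa using ht')
    | succ n ih =>
      intro t ht ht'
      rcases le_total t δ with h | h
      · exact (hbound t ht h).trans (le_self_pow₀ hC (by simp))
      · have h1 := ih (t - δ) (by linarith) (by push_cast at ht'; linarith)
        have h2 := hS.map_add δ (t - δ) hδ.le (by linarith)
        rw [add_sub_cancel] at h2
        rw [h2, pow_succ' C (n + 1)]
        exact (ContinuousLinearMap.opNorm_comp_le _ _).trans
          (mul_le_mul (hbound δ hδ.le le_rfl) h1 (norm_nonneg _) hC0.le)
  -- Splitting [0,t] into steps of length δ gives C^(⌊t/δ⌋+1) ≤ C e^(t log C / δ).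
  refine ⟨C, Real.log C / δ, hC0, div_nonneg (Real.log_nonneg hC) hδ.le, fun t ht => ?_⟩
  have hfl : (⌊t / δ⌋₊ : ℝ) ≤ t / δ := Nat.floor_le (by positivity)
  have hlt : t ≤ (⌊t / δ⌋₊ + 1) * δ := by
    rw [← div_le_iff₀ hδ]; exact (Nat.lt_floor_add_one _).le
  refine (hstep _ t ht hlt).trans ?_
  rw [pow_succ', ← Real.rpow_natCast, Real.rpow_def_of_pos hC0]
  refine mul_le_mul_of_nonneg_left (Real.exp_le_exp.2 ?_) hC0.le
  calc Real.log C * ⌊t / δ⌋₊ ≤ Real.log C * (t / δ) :=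
        mul_le_mul_of_nonneg_left hfl (Real.log_nonneg hC)
    _ = Real.log C / δ * t := by ring

/-- Factoring out S(min(s,t)), which is locally bounded, reduces two-sided continuity to right
continuity at 0. -/
theorem continuousOn_apply [CompleteSpace X] (hS : IsC0Semigroup S) (x : X) :
    ContinuousOn (fun t => S t x) (Set.Ici 0) := by
  obtain ⟨M, ω, hM, hω, hbound⟩ := hS.exists_norm_le_exp
  have hle : ∀ s t : ℝ, 0 ≤ s → s ≤ t →
      ‖S t x - S s x‖ ≤ M * Real.exp (ω * s) * ‖S (t - s) x - x‖ := by
    intro s t hs hst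
    have h := hS.map_add s (t - s) hs (by linarith)
    rw [add_sub_cancel] at h
    rw [h, ContinuousLinearMap.comp_apply, ← map_sub]
    exact (S s).le_of_opNorm_le (hbound s hs) _
  intro t ht
  have ht0 : 0 ≤ t := ht
  have hle' : ∀ s ∈ Set.Ici (0 : ℝ),
      ‖S s x - S t x‖ ≤ M * Real.exp (ω * t) * ‖S |s - t| x - x‖ := by
    intro s hs
    rcases le_total s t with h | h
    · rw [norm_sub_rev, abs_sub_comm, abs_of_nonneg (sub_nonneg.2 h)]
      refine (hle s t hs h).trans ?_
      gcongr
    · rw [abs_of_nonneg (sub_nonneg.2 h)]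
      exact hle t s ht0 h
  have habs : Tendsto (fun s : ℝ => |s - t|) (𝓝[Set.Ici 0] t) (𝓝[≥] 0) := by
    refine tendsto_nhdsWithin_iff.2 ⟨?_, Eventually.of_forall fun s => Set.mem_Ici.2 (abs_nonneg _)⟩
    have : Continuous fun s : ℝ => |s - t| := by fun_prop
    simpa using (this.tendsto t).mono_left nhdsWithin_le_nhds
  have hlim : Tendsto (fun s => M * Real.exp (ω * t) * ‖S |s - t| x - x‖) (𝓝[Set.Ici 0] t)
      (𝓝 0) := by
    simpa using ((((hS.tendsto_nhdsGE_zero x).comp habs).sub_const x).norm).const_mul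
      (M * Real.exp (ω * t))
  rw [ContinuousWithinAt, tendsto_iff_norm_sub_tendsto_zero]
  exact squeeze_zero' (Eventually.of_forall fun _ => norm_nonneg _)
    (by filter_upwards [self_mem_nhdsWithin] with s hs using hle' s hs) hlim

end IsC0Semigroup

/-! ### Weighted averages of a semigroup -/

section Average

variable {X : Type*} [NormedAddCommGroup X] [NormedSpace ℝ X] {S : ℝ → X →L[ℝ] X}
  {k : ℝ → ℝ} {C M ω c : ℝ}

/-- The rate ωc + 1 absorbs the growth of S(dξ) for every d ≤ c at once and leaves e^(-ξ). -/
theorem norm_smul_semigroup_le (hbound : ∀ t, 0 ≤ t → ‖S t‖ ≤ M * Real.exp (ω * t))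
    (hk : ∀ ξ, 0 ≤ ξ → |k ξ| ≤ C * Real.exp (-(ω * c + 1) * ξ)) {d ξ : ℝ} (hω : 0 ≤ ω)
    (hM : 0 < M) (hC : 0 < C) (hd : 0 ≤ d)
    (hdc : d ≤ c) (hξ : 0 ≤ ξ) (x : X) :
    ‖k ξ • S (d * ξ) x‖ ≤ (C * M * ‖x‖) * Real.exp (-1 * ξ) := by
  rw [norm_smul, Real.norm_eq_abs]
  have h1 : ‖S (d * ξ) x‖ ≤ M * Real.exp (ω * (c * ξ)) * ‖x‖ := by
    refine ((S (d * ξ)).le_of_opNorm_le (hbound _ (by positivity)) x).trans ?_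
    gcongr
  calc |k ξ| * ‖S (d * ξ) x‖
      ≤ (C * Real.exp (-(ω * c + 1) * ξ)) * (M * Real.exp (ω * (c * ξ)) * ‖x‖) := by
        gcongr
        exact hk ξ hξ
    _ = (C * M * ‖x‖) * (Real.exp (-(ω * c + 1) * ξ) * Real.exp (ω * (c * ξ))) := by ring
    _ = _ := by rw [← Real.exp_add]; ring_nf

theorem integrableOn_exp_neg_one_mul : IntegrableOn (fun ξ : ℝ => Real.exp (-1 * ξ)) (Set.Ioi 0) :=
  integrableOn_exp_mul_Ioi (by norm_num) 0

theorem integral_exp_neg_one_mul : ∫ ξ in Set.Ioi (0 : ℝ), Real.exp (-1 * ξ) = 1 := by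
  simpa using integral_exp_neg_Ioi_zero

theorem norm_integral_smul_semigroup_le
    (hbound : ∀ t, 0 ≤ t → ‖S t‖ ≤ M * Real.exp (ω * t))
    (hk : ∀ ξ, 0 ≤ ξ → |k ξ| ≤ C * Real.exp (-(ω * c + 1) * ξ)) {d : ℝ} (hω : 0 ≤ ω)
    (hM : 0 < M) (hC : 0 < C) (hd : 0 ≤ d) (hdc : d ≤ c) (x : X) :
    ‖∫ ξ in Set.Ioi 0, k ξ • S (d * ξ) x‖ ≤ C * M * ‖x‖ := by
  calc _ ≤ ∫ ξ in Set.Ioi (0 : ℝ), (C * M * ‖x‖) * Real.exp (-1 * ξ) := by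
        refine norm_integral_le_of_norm_le (integrableOn_exp_neg_one_mul.const_mul _) ?_
        filter_upwards [ae_restrict_mem measurableSet_Ioi] with ξ hξ
        exact norm_smul_semigroup_le hbound hk hω hM hC hd hdc (le_of_lt hξ) x
    _ = _ := by rw [integral_const_mul, integral_exp_neg_one_mul, mul_one]

/-- Dilations are continuous in exponentially weighted L¹ by dominated convergence; norm continuity
of T̂_α rests on this. -/
theorem tendsto_integral_dilation_sub (hkc : Continuous k)
    (hk : ∀ K : ℝ, ∃ C : ℝ, 0 < C ∧ ∀ ξ, 0 ≤ ξ → |k ξ| ≤ C * Real.exp (-K * ξ)) (ω : ℝ)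
    {b₀ : ℝ} (hb₀ : 0 < b₀) :
    Tendsto (fun b => ∫ η in Set.Ioi (0 : ℝ), |b * k (b * η) - b₀ * k (b₀ * η)| *
      Real.exp (ω * η)) (𝓝 b₀) (𝓝 0) ∧
    ∀ᶠ b in 𝓝 b₀, IntegrableOn (fun η => |b * k (b * η) - b₀ * k (b₀ * η)| * Real.exp (ω * η))
      (Set.Ioi 0) := by
  -- For b > b₀/2 this rate leaves decay at least |ω| + 1 in η, enough to beat the weight.
  obtain ⟨C, hC, hkC⟩ := hk (2 * (|ω| + 1) / b₀)
  have hone : ∀ b ∈ Set.Ioo (b₀ / 2) (2 * b₀), ∀ η : ℝ, 0 < η →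
      |b * k (b * η)| ≤ 2 * b₀ * C * Real.exp (-(|ω| + 1) * η) := by
    intro b hb η hη
    have hb0 : 0 < b := by linarith [hb.1]
    rw [abs_mul, abs_of_pos hb0]
    calc b * |k (b * η)| ≤ b * (C * Real.exp (-(2 * (|ω| + 1) / b₀) * (b * η))) := by
          gcongr; exact hkC _ (by positivity)
      _ ≤ (2 * b₀) * (C * Real.exp (-(|ω| + 1) * η)) := by
          have h1 : |ω| + 1 ≤ 2 * (|ω| + 1) / b₀ * b := by
            rw [div_mul_eq_mul_div, le_div_iff₀ hb₀]
            nlinarith [hb.1, abs_nonneg ω]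
          refine mul_le_mul hb.2.le (mul_le_mul_of_nonneg_left (Real.exp_le_exp.2 ?_) hC.le)
            (by positivity) (by positivity)
          nlinarith
      _ = _ := by ring
  have hmem : Set.Ioo (b₀ / 2) (2 * b₀) ∈ 𝓝 b₀ := Ioo_mem_nhds (by linarith) (by linarith)
  have hbd : ∀ b ∈ Set.Ioo (b₀ / 2) (2 * b₀), ∀ᵐ η ∂(volume.restrict (Set.Ioi (0 : ℝ))),
      ‖|b * k (b * η) - b₀ * k (b₀ * η)| * Real.exp (ω * η)‖ ≤
        4 * b₀ * C * Real.exp (-1 * η) := by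
    intro b hb
    filter_upwards [ae_restrict_mem measurableSet_Ioi] with η hη
    have hη0 : 0 < η := hη
    rw [norm_mul, Real.norm_of_nonneg (abs_nonneg _), Real.norm_of_nonneg (Real.exp_pos _).le]
    have h1 := hone b hb η hη
    have h2 := hone b₀ ⟨by linarith, by linarith⟩ η hη
    have h3 : Real.exp (ω * η) ≤ Real.exp (|ω| * η) := by
      gcongr
      exact le_abs_self ω
    calc _ ≤ (2 * b₀ * C * Real.exp (-(|ω| + 1) * η) + 2 * b₀ * C * Real.exp (-(|ω| + 1) * η)) *
          Real.exp (|ω| * η) := by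
          gcongr
          exact (abs_sub _ _).trans (add_le_add h1 h2)
      _ = 4 * b₀ * C * (Real.exp (-(|ω| + 1) * η) * Real.exp (|ω| * η)) := by ring
      _ = _ := by rw [← Real.exp_add]; ring_nf
  have hmeas : ∀ b : ℝ, AEStronglyMeasurable
      (fun η => |b * k (b * η) - b₀ * k (b₀ * η)| * Real.exp (ω * η))
      (volume.restrict (Set.Ioi (0 : ℝ))) := fun b => by
    refine Continuous.aestronglyMeasurable ?_
    fun_prop
  refine ⟨?_, ?_⟩
  · have h := continuousAt_of_dominated (μ := volume.restrict (Set.Ioi (0 : ℝ)))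
      (F := fun b η => |b * k (b * η) - b₀ * k (b₀ * η)| * Real.exp (ω * η)) (x₀ := b₀)
      (Eventually.of_forall hmeas) (by filter_upwards [hmem] with b hb using hbd b hb)
      (integrableOn_exp_neg_one_mul.const_mul _)
      (Eventually.of_forall fun η => by
        refine Continuous.continuousAt ?_
        fun_prop)
    simpa [ContinuousAt] using h
  · filter_upwards [hmem] with b hb
    exact (integrableOn_exp_neg_one_mul.const_mul _).mono' (hmeas b) (hbd b hb)

variable [CompleteSpace X]

theorem aestronglyMeasurable_smul_semigroup (hS : IsC0Semigroup S) (hk : Continuous k) {d : ℝ}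
    (hd : 0 ≤ d) (x : X) :
    AEStronglyMeasurable (fun ξ => k ξ • S (d * ξ) x) (volume.restrict (Set.Ioi 0)) := by
  refine ContinuousOn.aestronglyMeasurable ?_ measurableSet_Ioi
  refine hk.continuousOn.smul ((hS.continuousOn_apply x).comp (by fun_prop) fun ξ hξ => ?_)
  exact mul_nonneg hd (le_of_lt hξ)

theorem integrableOn_smul_semigroup (hS : IsC0Semigroup S) (hkc : Continuous k)
    (hbound : ∀ t, 0 ≤ t → ‖S t‖ ≤ M * Real.exp (ω * t))
    (hk : ∀ ξ, 0 ≤ ξ → |k ξ| ≤ C * Real.exp (-(ω * c + 1) * ξ)) {d : ℝ} (hω : 0 ≤ ω)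
    (hM : 0 < M) (hC : 0 < C) (hd : 0 ≤ d) (hdc : d ≤ c) (x : X) :
    IntegrableOn (fun ξ => k ξ • S (d * ξ) x) (Set.Ioi 0) := by
  refine (integrableOn_exp_neg_one_mul.const_mul (C * M * ‖x‖)).mono'
    (aestronglyMeasurable_smul_semigroup hS hkc hd x) ?_
  filter_upwards [ae_restrict_mem measurableSet_Ioi] with ξ hξ
  exact norm_smul_semigroup_le hbound hk hω hM hC hd hdc (le_of_lt hξ) x

end Average

/-! ### The operators `T̂_α(t)` and `T_α(t)` -/

theorem exists_abs_mul_wrightM_le {a : ℝ} (ha : 0 < a) (ha' : a < 1) (K : ℝ) :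
    ∃ C : ℝ, 0 < C ∧ ∀ x : ℝ, 0 ≤ x → |x * wrightM a x| ≤ C * Real.exp (-K * x) := by
  obtain ⟨C, hC, h⟩ := exists_abs_wrightM_le ha ha' (K + 1)
  refine ⟨C, hC, fun x hx => ?_⟩
  rw [abs_mul, abs_of_nonneg hx]
  have h1 : x ≤ Real.exp x := by linarith [Real.add_one_le_exp x]
  calc x * |wrightM a x| ≤ Real.exp x * (C * Real.exp (-(K + 1) * x)) := by
        gcongr
        exact h x hx
    _ = C * (Real.exp x * Real.exp (-(K + 1) * x)) := by ring
    _ = _ := by rw [← Real.exp_add]; ring_nf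

theorem continuous_mul_wrightM {a : ℝ} (ha : 0 < a) (ha' : a < 1) :
    Continuous fun x => x * wrightM a x :=
  continuous_id.mul (continuous_wrightM ha ha')

section Operators

variable {X : Type*} [NormedAddCommGroup X] [NormedSpace ℝ X] {S : ℝ → X →L[ℝ] X} {a : ℝ}

theorem mul_subordDensity_smul_eqOn (ha : 0 < a) (c : ℝ) (x : X) :
    Set.EqOn (fun ξ => (ξ * subordDensity a ξ) • S (c * ξ) x)
      (fun ξ => (ξ * wrightM a ξ) • S (c * ξ) x) (Set.Ioi 0) := fun ξ hξ => by
  simp only [subordDensity_eq_wrightM ha hξ]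

theorem hatTVec_eq (ha : 0 < a) (t : ℝ) (x : X) :
    hatTVec S a t x = a • ∫ ξ in Set.Ioi (0 : ℝ), (ξ * wrightM a ξ) • S (t ^ a * ξ) x := by
  rw [hatTVec, setIntegral_congr_fun measurableSet_Ioi (mul_subordDensity_smul_eqOn ha _ x)]

/-- The parameter moves from the semigroup, which is only strongly continuous, to the scalar kernel.
-/
theorem integral_dilation_smul (c : ℝ) (hc : 0 < c) (k : ℝ → ℝ) (x : X) :
    ∫ ξ in Set.Ioi (0 : ℝ), k ξ • S (c * ξ) x =
      ∫ η in Set.Ioi (0 : ℝ), (c⁻¹ * k (c⁻¹ * η)) • S η x := by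
  have h := integral_comp_mul_left_Ioi (fun η => k (c⁻¹ * η) • S η x) 0 hc
  rw [mul_zero] at h
  simp only [mul_smul]
  rw [integral_smul, ← h]
  simp only [inv_mul_cancel_left₀ hc.ne']

variable [CompleteSpace X]

theorem integrableOn_mul_wrightM_smul (hS : IsC0Semigroup S) (ha : 0 < a) (ha' : a < 1) {c : ℝ}
    (hc : 0 ≤ c) (x : X) :
    IntegrableOn (fun ξ => (ξ * wrightM a ξ) • S (c * ξ) x) (Set.Ioi 0) := by
  obtain ⟨M, ω, hM, hω, hbound⟩ := hS.exists_norm_le_exp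
  obtain ⟨C, hC, hk⟩ := exists_abs_mul_wrightM_le ha ha' (ω * c + 1)
  exact integrableOn_smul_semigroup hS (continuous_mul_wrightM ha ha') hbound hk hω hM hC hc le_rfl x

theorem integrableOn_mul_subordDensity_smul (hS : IsC0Semigroup S) (ha : 0 < a) (ha' : a < 1)
    {c : ℝ} (hc : 0 ≤ c) (x : X) :
    IntegrableOn (fun ξ => (ξ * subordDensity a ξ) • S (c * ξ) x) (Set.Ioi 0) :=
  (integrableOn_mul_wrightM_smul hS ha ha' hc x).congr_fun
    (mul_subordDensity_smul_eqOn ha c x).symm measurableSet_Ioi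

theorem exists_norm_hatTVec_le (hS : IsC0Semigroup S) (ha : 0 < a) (ha' : a < 1) (T : ℝ) :
    ∃ D : ℝ, 0 < D ∧ ∀ t, 0 ≤ t → t ≤ T → ∀ x, ‖hatTVec S a t x‖ ≤ D * ‖x‖ := by
  obtain ⟨M, ω, hM, hω, hbound⟩ := hS.exists_norm_le_exp
  obtain ⟨C, hC, hk⟩ := exists_abs_mul_wrightM_le ha ha' (ω * T ^ a + 1)
  refine ⟨a * (C * M), by positivity, fun t ht htT x => ?_⟩
  rw [hatTVec_eq ha, norm_smul, Real.norm_of_nonneg ha.le, mul_assoc]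
  gcongr
  exact norm_integral_smul_semigroup_le hbound hk hω hM hC (Real.rpow_nonneg ht a)
    (Real.rpow_le_rpow ht htT ha.le) x

theorem hatT_apply (hS : IsC0Semigroup S) (ha : 0 < a) (ha' : a < 1) {t : ℝ} (ht : 0 ≤ t) (x : X) :
    hatT S a t x = hatTVec S a t x := by
  have hinteg := integrableOn_mul_wrightM_smul hS ha ha' (Real.rpow_nonneg ht a)
  obtain ⟨D, -, hD⟩ := exists_norm_hatTVec_le hS ha ha' t
  have hex : ∃ L : X →L[ℝ] X, ∀ x, L x = hatTVec S a t x := by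
    refine ⟨LinearMap.mkContinuous
      { toFun := hatTVec S a t
        map_add' := fun x y => ?_
        map_smul' := fun r x => ?_ } D (hD t ht le_rfl), fun x => rfl⟩
    · simp only [hatTVec_eq ha, map_add, smul_add]
      rw [integral_add (hinteg x) (hinteg y), smul_add]
    · simp only [hatTVec_eq ha, map_smul, RingHom.id_apply]
      simp only [smul_comm _ r]
      rw [integral_smul, smul_comm r a]
  rw [hatT, dif_pos hex]
  exact hex.choose_spec x

theorem exists_norm_hatT_le (hS : IsC0Semigroup S) (ha : 0 < a) (ha' : a < 1) (T : ℝ) :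
    ∃ D : ℝ, 0 < D ∧ ∀ t, 0 ≤ t → t ≤ T → ‖hatT S a t‖ ≤ D := by
  obtain ⟨D, hD, h⟩ := exists_norm_hatTVec_le hS ha ha' T
  refine ⟨D, hD, fun t ht htT => ContinuousLinearMap.opNorm_le_bound _ hD.le fun x => ?_⟩
  rw [hatT_apply hS ha ha' ht]
  exact h t ht htT x

/-- `T̂_α` is continuous in the operator norm on `(0, ∞)`. -/
theorem continuousOn_hatT (hS : IsC0Semigroup S) (ha : 0 < a) (ha' : a < 1) :
    ContinuousOn (hatT S a) (Set.Ioi 0) := by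
  intro t₀ ht₀
  have ht₀' : 0 < t₀ := ht₀
  refine ContinuousAt.continuousWithinAt ?_
  obtain ⟨M, ω, hM, hω, hbound⟩ := hS.exists_norm_le_exp
  have hb₀ : 0 < (t₀ ^ a)⁻¹ := inv_pos.2 (Real.rpow_pos_of_pos ht₀' a)
  -- With b = t^(-a), the operator norm of the difference is at most aM times the weighted L¹
  -- distance of the dilated kernels.
  obtain ⟨hlim, hinteg⟩ := tendsto_integral_dilation_sub (continuous_mul_wrightM ha ha')
    (exists_abs_mul_wrightM_le ha ha') ω hb₀
  have hbt : Tendsto (fun t : ℝ => (t ^ a)⁻¹) (𝓝 t₀) (𝓝 (t₀ ^ a)⁻¹) :=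
    ((Real.continuousAt_rpow_const t₀ a (Or.inl ht₀'.ne')).inv₀
      (Real.rpow_pos_of_pos ht₀' a).ne').tendsto
  have hlim' := ((hlim.comp hbt).mul_const M).const_mul a
  rw [zero_mul, mul_zero] at hlim'
  have hintk : ∀ t : ℝ, 0 < t → ∀ x, IntegrableOn (fun η =>
      ((t ^ a)⁻¹ * ((t ^ a)⁻¹ * η * wrightM a ((t ^ a)⁻¹ * η))) • S η x) (Set.Ioi 0) := by
    intro t ht x
    have hta := Real.rpow_pos_of_pos ht a
    have h := (integrableOn_mul_wrightM_smul hS ha ha' hta.le x)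
    have h2 := (integrableOn_Ioi_comp_mul_left_iff
      (fun η => ((t ^ a)⁻¹ * η * wrightM a ((t ^ a)⁻¹ * η)) • S η x) 0 hta).1
      (by simpa only [inv_mul_cancel_left₀ hta.ne', mul_zero] using h)
    rw [mul_zero] at h2
    exact (h2.smul (t ^ a)⁻¹).congr (Eventually.of_forall fun η => smul_smul _ _ _)
  rw [ContinuousAt, tendsto_iff_norm_sub_tendsto_zero]
  refine squeeze_zero' (Eventually.of_forall fun _ => norm_nonneg _) ?_ hlim'
  filter_upwards [hbt.eventually hinteg, Ioi_mem_nhds ht₀'] with t hti ht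
  have ht' : 0 < t := ht
  simp only [Function.comp]
  refine ContinuousLinearMap.opNorm_le_bound _
    (mul_nonneg ha.le (mul_nonneg (integral_nonneg fun η => by positivity) hM.le)) fun x => ?_
  rw [sub_apply, hatT_apply hS ha ha' ht'.le, hatT_apply hS ha ha' ht₀'.le,
    hatTVec_eq ha, hatTVec_eq ha, integral_dilation_smul _ (Real.rpow_pos_of_pos ht' a)
      (fun ξ => ξ * wrightM a ξ),
    integral_dilation_smul _ (Real.rpow_pos_of_pos ht₀' a) (fun ξ => ξ * wrightM a ξ),
    ← smul_sub, norm_smul, Real.norm_of_nonneg ha.le,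
    ← integral_sub (hintk t ht' x) (hintk t₀ ht₀' x), mul_assoc a, mul_assoc _ M]
  refine mul_le_mul_of_nonneg_left ?_ ha.le
  rw [← integral_mul_const]
  refine norm_integral_le_of_norm_le (hti.mul_const _) ?_
  filter_upwards [ae_restrict_mem measurableSet_Ioi] with η hη
  rw [← sub_smul, norm_smul, Real.norm_eq_abs, mul_assoc |_|]
  refine mul_le_mul_of_nonneg_left ?_ (abs_nonneg _)
  exact ((S η).le_of_opNorm_le (hbound η (le_of_lt hη)) x).trans_eq (by ring)

theorem continuousOn_fracT (hS : IsC0Semigroup S) (ha : 0 < a) (ha' : a < 1) (T : ℝ) (x : X) :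
    ContinuousOn (fun t => fracT S a t x) (Set.Icc 0 T) := by
  obtain ⟨M, ω, hM, hω, hbound⟩ := hS.exists_norm_le_exp
  obtain ⟨C, hC, hk⟩ := exists_abs_wrightM_le ha ha' (ω * T ^ a + 1)
  have heq : ∀ t, fracT S a t x = ∫ ξ in Set.Ioi (0 : ℝ), wrightM a ξ • S (t ^ a * ξ) x := fun t =>
    setIntegral_congr_fun measurableSet_Ioi fun ξ hξ => by
      simp only [subordDensity_eq_wrightM ha hξ]
  simp only [heq]
  intro t₀ ht₀
  refine continuousWithinAt_of_dominated (bound := fun ξ => (C * M * ‖x‖) * Real.exp (-1 * ξ))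
    ?_ ?_ (integrableOn_exp_neg_one_mul.const_mul _) ?_
  · filter_upwards [self_mem_nhdsWithin] with t ht
    exact aestronglyMeasurable_smul_semigroup hS (continuous_wrightM ha ha')
      (Real.rpow_nonneg ht.1 a) x
  · filter_upwards [self_mem_nhdsWithin] with t ht
    filter_upwards [ae_restrict_mem measurableSet_Ioi] with ξ hξ
    exact norm_smul_semigroup_le hbound hk hω hM hC (Real.rpow_nonneg ht.1 a)
      (Real.rpow_le_rpow ht.1 ht.2 ha.le) (le_of_lt hξ) x
  · filter_upwards [ae_restrict_mem measurableSet_Ioi] with ξ hξ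
    refine continuousWithinAt_const.smul ?_
    refine ((hS.continuousOn_apply x).comp (f := fun t : ℝ => t ^ a * ξ) (s := Set.Icc 0 T)
      ((Real.continuous_rpow_const ha.le).mul continuous_const).continuousOn fun t ht => ?_) t₀ ht₀
    exact mul_nonneg (Real.rpow_nonneg ht.1 a) (le_of_lt hξ)

end Operators

/-! ### The equation `λ w + Φ J[w] = h` for a symmetric nonnegative `Φ` -/

/-- Divide by s and let s ↓ 0. It supplies first-order conditions where the dual norm need not be
differentiable. -/
theorem nonneg_of_forall_linear_add_quadratic {A B : ℝ}
    (h : ∀ s : ℝ, 0 < s → s ≤ 1 → 0 ≤ s * A + s ^ 2 * B) : 0 ≤ A := by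
  by_contra! hA
  -- This s makes s|B| at most |A|/2, so A + sB would be negative.
  have hs : 0 < min 1 (-A / (2 * (|B| + 1))) := lt_min one_pos (div_pos (by linarith) (by positivity))
  have h1 := h _ hs (min_le_left _ _)
  set s := min 1 (-A / (2 * (|B| + 1))) with hsdef
  have h2 : s * (2 * (|B| + 1)) ≤ -A := by
    rw [← le_div_iff₀ (by positivity)]; exact min_le_right _ _
  have h3 : 0 ≤ A + s * B := by
    by_contra! hneg
    nlinarith
  nlinarith [le_abs_self B, abs_nonneg B]

section Duality

variable {X : Type*} [NormedAddCommGroup X] [NormedSpace ℝ X]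

/-- Hahn–Banach separation; a functional bounded above on a subspace vanishes on it. -/
theorem dense_of_forall_dual_eq_zero (V : Submodule ℝ X)
    (h : ∀ f : StrongDual ℝ X, (∀ v ∈ V, f v = 0) → f = 0) : Dense (V : Set X) := by
  intro x
  by_contra hx
  obtain ⟨f, u, hf, hu⟩ := geometric_hahn_banach_closed_point
    (V.convex.closure) isClosed_closure hx
  have hf' : ∀ v ∈ V, f v < u := fun v hv => hf v (subset_closure hv)
  have hzero : ∀ v ∈ V, f v = 0 := by
    intro v hv
    by_contra hne
    have := hf' (((u + 1) / f v) • v) (V.smul_mem _ hv)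
    rw [map_smul, smul_eq_mul, div_mul_cancel₀ _ hne] at this
    linarith
  have h0 := hf' 0 V.zero_mem
  rw [h f hzero] at hu h0
  simp only [zero_apply] at hu h0
  linarith

theorem dualityMap_norm_eq {w : X} {f : StrongDual ℝ X} (hf : f ∈ dualityMap w) : ‖f‖ = ‖w‖ :=
  (pow_left_inj₀ (norm_nonneg _) (norm_nonneg _) two_ne_zero).1 hf.2

/-- At w the sum f + g takes the value 2‖w‖², which forces ‖f + g‖ = ‖f‖ + ‖g‖; strict convexity
then gives f = g. -/
theorem dualityMap_subsingleton [StrictConvexSpace ℝ (StrongDual ℝ X)] {w : X}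
    {f g : StrongDual ℝ X} (hf : f ∈ dualityMap w) (hg : g ∈ dualityMap w) : f = g := by
  have hfn := dualityMap_norm_eq hf
  have hgn := dualityMap_norm_eq hg
  refine eq_of_norm_eq_of_norm_add_eq (hfn.trans hgn.symm) ?_
  refine le_antisymm (norm_add_le _ _) ?_
  rw [hfn, hgn]
  rcases (norm_nonneg w).eq_or_lt with h0 | hpos
  · rw [← h0]; simp
  · have h1 : (f + g) w = ‖w‖ ^ 2 + ‖w‖ ^ 2 := by rw [add_apply, hf.1, hg.1]
    have h2 : (f + g) w ≤ ‖f + g‖ * ‖w‖ := (le_abs_self _).trans ((f + g).le_opNorm w)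
    nlinarith

variable {Φ : StrongDual ℝ X →ₗ[ℝ] X}

/-- Positivity of Φ gives (f₁-f₂)(w₁-w₂) ≤ 0, while the left side is at least (‖w₁‖-‖w₂‖)². Equality
makes f₁ a duality functional of w₂ too, so f₁ = f₂ and then w₁ = w₂. -/
theorem solvesResolventEq_unique [StrictConvexSpace ℝ (StrongDual ℝ X)]
    (hpos : ∀ f : StrongDual ℝ X, 0 ≤ f (Φ f)) {lam : ℝ} (hlam : 0 < lam) {h w₁ w₂ : X}
    (h₁ : SolvesResolventEq Φ lam h w₁) (h₂ : SolvesResolventEq Φ lam h w₂) : w₁ = w₂ := by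
  obtain ⟨f₁, hf₁, he₁⟩ := h₁
  obtain ⟨f₂, hf₂, he₂⟩ := h₂
  have hsub : lam • (w₁ - w₂) + Φ (f₁ - f₂) = 0 := by
    rw [map_sub, smul_sub]
    have h12 := he₁.trans he₂.symm
    rw [← sub_eq_zero] at h12
    rw [← h12]
    abel
  have hle : (f₁ - f₂) (w₁ - w₂) ≤ 0 := by
    have h3 := congrArg (f₁ - f₂) hsub
    rw [map_add, map_smul, smul_eq_mul, map_zero] at h3
    have := hpos (f₁ - f₂)
    by_contra! hlt
    nlinarith [mul_pos hlam hlt]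
  have hn₁ := dualityMap_norm_eq hf₁
  have hn₂ := dualityMap_norm_eq hf₂
  have hb₁ : f₁ w₂ ≤ ‖w₁‖ * ‖w₂‖ := by
    rw [← hn₁]; exact (le_abs_self _).trans (f₁.le_opNorm w₂)
  have hb₂ : f₂ w₁ ≤ ‖w₂‖ * ‖w₁‖ := by
    rw [← hn₂]; exact (le_abs_self _).trans (f₂.le_opNorm w₁)
  have hexp : (f₁ - f₂) (w₁ - w₂) = ‖w₁‖ ^ 2 + ‖w₂‖ ^ 2 - f₁ w₂ - f₂ w₁ := by
    rw [sub_apply, map_sub, map_sub, hf₁.1, hf₂.1]; ring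
  have hnorm : ‖w₁‖ = ‖w₂‖ := by
    have : (‖w₁‖ - ‖w₂‖) ^ 2 ≤ 0 := by nlinarith
    have := pow_eq_zero_iff two_ne_zero |>.1 (le_antisymm this (sq_nonneg _))
    linarith
  have hf₁w₂ : f₁ w₂ = ‖w₂‖ ^ 2 := by
    rw [hnorm] at hb₁ hb₂ hexp
    nlinarith
  have hfeq : f₁ = f₂ := dualityMap_subsingleton (w := w₂) ⟨hf₁w₂, by rw [hn₁, hnorm]⟩ hf₂
  rw [hfeq, sub_self, map_zero, add_zero] at hsub
  exact sub_eq_zero.1 ((smul_eq_zero.1 hsub).resolve_left hlam.ne')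

/-- The functional whose minimiser on the dual space gives the solution. -/
def resolventEnergy (Φ : StrongDual ℝ X →ₗ[ℝ] X) (lam : ℝ) (h : X) (f : StrongDual ℝ X) : ℝ :=
  lam / 2 * ‖f‖ ^ 2 + (1 / 2 * f (Φ f) - f h)

theorem quadratic_add (hsymm : ∀ f g : StrongDual ℝ X, f (Φ g) = g (Φ f)) (f d : StrongDual ℝ X) (s : ℝ) :
    (f + s • d) (Φ (f + s • d)) = f (Φ f) + 2 * s * d (Φ f) + s ^ 2 * d (Φ d) := by
  simp only [map_add, map_smul, add_apply, smul_apply, smul_eq_mul]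
  rw [hsymm f d]
  ring

/-- Dual balls are weak*-closed. The nonnegative quadratic form lies above its tangents f ↦ f(Φg) -
1/2 g(Φg), which are weak*-continuous because Φg is in X. -/
theorem lowerSemicontinuous_resolventEnergy (hsymm : ∀ f g : StrongDual ℝ X, f (Φ g) = g (Φ f))
    (hpos : ∀ f : StrongDual ℝ X, 0 ≤ f (Φ f)) {lam : ℝ} (hlam : 0 < lam) (h : X) :
    LowerSemicontinuous fun f : WeakDual ℝ X =>
      resolventEnergy Φ lam h (WeakDual.toStrongDual f) := by
  have h1 : LowerSemicontinuous fun f : WeakDual ℝ X =>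
      lam / 2 * ‖WeakDual.toStrongDual f‖ ^ 2 := by
    rw [lowerSemicontinuous_iff_isClosed_preimage]
    intro y
    rcases lt_or_ge y 0 with hy | hy
    · convert isClosed_empty
      ext f
      simp only [Set.mem_preimage, Set.mem_Iic, Set.mem_empty_iff_false, iff_false, not_le]
      exact hy.trans_le (by positivity)
    · convert WeakDual.isClosed_closedBall (0 : StrongDual ℝ X) (Real.sqrt (2 * y / lam)) using 1
      ext f
      simp only [Set.mem_preimage, Set.mem_Iic, mem_closedBall_zero_iff]
      rw [Real.le_sqrt (norm_nonneg _) (by positivity), le_div_iff₀ hlam]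
      constructor <;> intro h <;> linarith
  have h2 : LowerSemicontinuous fun f : WeakDual ℝ X =>
      1 / 2 * (WeakDual.toStrongDual f) (Φ (WeakDual.toStrongDual f)) -
        (WeakDual.toStrongDual f) h := by
    intro f₀ y hy
    set g := WeakDual.toStrongDual f₀ with hg
    have hcont : Continuous fun f : WeakDual ℝ X => f (Φ g) - 1 / 2 * g (Φ g) - f h :=
      ((WeakDual.eval_continuous (Φ g)).sub continuous_const).sub (WeakDual.eval_continuous h)
    have hval : y < f₀ (Φ g) - 1 / 2 * g (Φ g) - f₀ h := by
      have : f₀ (Φ g) = g (Φ g) := rfl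
      have h' : f₀ h = g h := rfl
      rw [this, h']
      linarith
    filter_upwards [hcont.continuousAt.eventually (lt_mem_nhds hval)] with f hf
    have hq := hpos (WeakDual.toStrongDual f + (-1 : ℝ) • g)
    rw [quadratic_add hsymm, hsymm g] at hq
    have h3 : f (Φ g) = (WeakDual.toStrongDual f) (Φ g) := rfl
    have h4 : f h = (WeakDual.toStrongDual f) h := rfl
    rw [h3, h4] at hf
    linarith
  exact h1.add h2

theorem exists_forall_resolventEnergy_le (hsymm : ∀ f g : StrongDual ℝ X, f (Φ g) = g (Φ f))
    (hpos : ∀ f : StrongDual ℝ X, 0 ≤ f (Φ f)) {lam : ℝ} (hlam : 0 < lam) (h : X) :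
    ∃ f, ∀ g, resolventEnergy Φ lam h f ≤ resolventEnergy Φ lam h g := by
  -- Beyond this radius the energy is nonnegative, hence no better than at 0; the ball is
  -- weak*-compact by Banach–Alaoglu.
  set r := 2 * ‖h‖ / lam with hr
  have hr0 : 0 ≤ r := by positivity
  obtain ⟨f, -, hf⟩ := (lowerSemicontinuous_resolventEnergy hsymm hpos hlam h).lowerSemicontinuousOn
    (WeakDual.toStrongDual ⁻¹' Metric.closedBall (0 : StrongDual ℝ X) r)
    |>.exists_isMinOn ⟨0, by simpa using hr0⟩ (WeakDual.isCompact_closedBall 0 r)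
  have hf' : ∀ g : StrongDual ℝ X, ‖g‖ ≤ r →
      resolventEnergy Φ lam h (WeakDual.toStrongDual f) ≤ resolventEnergy Φ lam h g := fun g hg =>
    hf (a := StrongDual.toWeakDual g) (by simpa using hg)
  refine ⟨WeakDual.toStrongDual f, fun g => ?_⟩
  rcases le_or_gt ‖g‖ r with hg | hg
  · exact hf' g hg
  · refine (hf' 0 (by simpa using hr0)).trans ?_
    have h1 : g h ≤ ‖g‖ * ‖h‖ := (le_abs_self _).trans (g.le_opNorm h)
    have h2 : 2 * ‖h‖ ≤ lam * ‖g‖ := by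
      rw [hr, div_lt_iff₀ hlam] at hg; linarith
    have h3 := hpos g
    have h4 : ‖g‖ * ‖h‖ ≤ lam / 2 * ‖g‖ ^ 2 := by nlinarith [norm_nonneg g]
    simp only [resolventEnergy, norm_zero, zero_apply]
    linarith

/-- At a minimiser f, the vector w = (h - Φf)/λ is a subgradient of 1/2 ‖·‖² at f, which amounts to
f ∈ J[w]. -/
theorem solvesResolventEq_of_forall_le (hsymm : ∀ f g : StrongDual ℝ X, f (Φ g) = g (Φ f)) {lam : ℝ}
    (hlam : 0 < lam) {h : X} {f : StrongDual ℝ X}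
    (hf : ∀ g, resolventEnergy Φ lam h f ≤ resolventEnergy Φ lam h g) :
    SolvesResolventEq Φ lam h (lam⁻¹ • (h - Φ f)) := by
  set w := lam⁻¹ • (h - Φ f) with hw
  have hlw : lam • w = h - Φ f := smul_inv_smul₀ hlam.ne' _
  -- The subgradient inequality, from comparing f with f + s(g-f) and using convexity of the squared
  -- norm.
  have hvar : ∀ g : StrongDual ℝ X, (g - f) w ≤ 1 / 2 * (‖g‖ ^ 2 - ‖f‖ ^ 2) := by
    intro g
    have hA := nonneg_of_forall_linear_add_quadratic
      (A := lam / 2 * (‖g‖ ^ 2 - ‖f‖ ^ 2) + (g - f) (Φ f) - (g - f) h)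
      (B := 1 / 2 * (g - f) (Φ (g - f))) fun s hs hs1 => by
        have h1 := hf (f + s • (g - f))
        have hn : ‖f + s • (g - f)‖ ^ 2 ≤ (1 - s) * ‖f‖ ^ 2 + s * ‖g‖ ^ 2 := by
          have h2 : ‖f + s • (g - f)‖ ≤ (1 - s) * ‖f‖ + s * ‖g‖ := by
            calc ‖f + s • (g - f)‖ = ‖(1 - s) • f + s • g‖ := by congr 1; module
              _ ≤ ‖(1 - s) • f‖ + ‖s • g‖ := norm_add_le _ _
              _ = _ := by
                rw [norm_smul, norm_smul, Real.norm_of_nonneg (by linarith : 0 ≤ 1 - s),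
                  Real.norm_of_nonneg hs.le]
          calc ‖f + s • (g - f)‖ ^ 2 ≤ ((1 - s) * ‖f‖ + s * ‖g‖) ^ 2 := by gcongr
            _ ≤ _ := by
              nlinarith [mul_nonneg (mul_nonneg hs.le (by linarith : 0 ≤ 1 - s))
                (sq_nonneg (‖f‖ - ‖g‖))]
        unfold resolventEnergy at h1
        rw [quadratic_add hsymm] at h1
        have h3 : (f + s • (g - f)) h = f h + s * (g - f) h := by
          simp only [add_apply, smul_apply, smul_eq_mul]
        rw [h3] at h1
        nlinarith [mul_le_mul_of_nonneg_left hn (by positivity : 0 ≤ lam / 2)]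
    have h5 : lam * (g - f) w = (g - f) h - (g - f) (Φ f) := by
      rw [← smul_eq_mul, ← map_smul, hlw, map_sub]
    by_contra! hlt
    nlinarith [mul_lt_mul_of_pos_left hlt hlam]
  -- Tested on multiples of f, with scale factors on both sides of 1.
  have hfw : f w = ‖f‖ ^ 2 := by
    have hscale : ∀ s : ℝ, s * f w ≤ 1 / 2 * ((1 + s) ^ 2 - 1) * ‖f‖ ^ 2 := by
      intro s
      have h1 := hvar ((1 + s) • f)
      rw [norm_smul, mul_pow, Real.norm_eq_abs, sq_abs] at h1
      simp only [sub_apply, smul_apply, smul_eq_mul] at h1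
      linarith
    refine le_antisymm ?_ ?_
    · have := nonneg_of_forall_linear_add_quadratic (A := ‖f‖ ^ 2 - f w) (B := 1 / 2 * ‖f‖ ^ 2)
        fun s _ _ => by linarith [hscale s]
      linarith
    · have := nonneg_of_forall_linear_add_quadratic (A := f w - ‖f‖ ^ 2) (B := 1 / 2 * ‖f‖ ^ 2)
        fun s _ _ => by linarith [hscale (-s)]
      linarith
  have hle : ‖f‖ ^ 2 ≤ ‖f‖ * ‖w‖ := by
    rw [← hfw]; exact (le_abs_self _).trans (f.le_opNorm w)
  -- Tested on ‖w‖ times a norming functional of w.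
  have hge : ‖w‖ ^ 2 ≤ ‖f‖ ^ 2 := by
    obtain ⟨g, hg, hgw⟩ := exists_dual_vector'' ℝ w
    have h1 := hvar (‖w‖ • g)
    rw [norm_smul ‖w‖ g, norm_norm w, sub_apply, smul_apply, smul_eq_mul, hgw, hfw,
      mul_pow] at h1
    have h2 : ‖g‖ ^ 2 ≤ 1 := pow_le_one₀ (norm_nonneg _) hg
    have h3 : ‖w‖ ^ 2 * ‖g‖ ^ 2 ≤ ‖w‖ ^ 2 := mul_le_of_le_one_right (sq_nonneg _) h2
    simp only [RCLike.ofReal_real_eq_id, id] at h1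
    nlinarith
  have heq : ‖f‖ ^ 2 = ‖w‖ ^ 2 := by
    refine le_antisymm ?_ hge
    nlinarith [sq_nonneg (‖f‖ - ‖w‖), norm_nonneg f, norm_nonneg w]
  exact ⟨f, ⟨hfw.trans heq, heq⟩, by rw [hlw]; abel⟩

theorem existsUnique_solvesResolventEq [StrictConvexSpace ℝ (StrongDual ℝ X)]
    (hsymm : ∀ f g : StrongDual ℝ X, f (Φ g) = g (Φ f)) (hpos : ∀ f : StrongDual ℝ X, 0 ≤ f (Φ f)) {lam : ℝ} (hlam : 0 < lam)
    (h : X) : ∃! w, SolvesResolventEq Φ lam h w := by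
  obtain ⟨f, hf⟩ := exists_forall_resolventEnergy_le hsymm hpos hlam h
  exact ⟨_, solvesResolventEq_of_forall_le hsymm hlam hf, fun w hw =>
    solvesResolventEq_unique hpos hlam hw (solvesResolventEq_of_forall_le hsymm hlam hf)⟩

/-- Pair the equation with f, split h = (h - Φg) + Φg, and use 2 f(Φg) ≤ f(Φf) + g(Φg) to absorb the
cross term. -/
theorem sq_norm_smul_solution_le (hsymm : ∀ f g : StrongDual ℝ X, f (Φ g) = g (Φ f)) (hpos : ∀ f : StrongDual ℝ X, 0 ≤ f (Φ f))
    {lam : ℝ} (hlam : 0 < lam) {h w : X} (hw : SolvesResolventEq Φ lam h w)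
    (g : StrongDual ℝ X) :
    (lam * ‖w‖) ^ 2 ≤ lam * (1 / 2 * g (Φ g)) + ‖h - Φ g‖ * (lam * ‖w‖) := by
  obtain ⟨f, hf, he⟩ := hw
  have hfn := dualityMap_norm_eq hf
  have h1 : lam * ‖w‖ ^ 2 + f (Φ f) = f (h - Φ g) + f (Φ g) := by
    rw [← map_add, sub_add_cancel, ← he, map_add, map_smul, hf.1, smul_eq_mul]
  have h2 : f (h - Φ g) ≤ ‖w‖ * ‖h - Φ g‖ := by
    rw [← hfn]; exact (le_abs_self _).trans (f.le_opNorm _)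
  have h3 := hpos (f + (-1 : ℝ) • g)
  rw [quadratic_add hsymm, hsymm g f] at h3
  have h4 : lam * ‖w‖ ^ 2 ≤ ‖w‖ * ‖h - Φ g‖ + 1 / 2 * g (Φ g) := by linarith [hpos f]
  nlinarith [mul_le_mul_of_nonneg_left h4 hlam.le]

theorem tendsto_smul_of_denseRange (hsymm : ∀ f g : StrongDual ℝ X, f (Φ g) = g (Φ f)) (hpos : ∀ f : StrongDual ℝ X, 0 ≤ f (Φ f))
    (hdense : DenseRange Φ) (h : X) {R : ℝ → X}
    (hR : ∀ lam, 0 < lam → SolvesResolventEq Φ lam h (R lam)) :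
    Tendsto (fun lam : ℝ => lam • R lam) (𝓝[>] 0) (𝓝 0) := by
  rw [Metric.tendsto_nhds]
  intro ε hε
  obtain ⟨g, hg⟩ := hdense.exists_dist_lt h (half_pos hε)
  rw [dist_eq_norm] at hg
  have hev : ∀ᶠ lam : ℝ in 𝓝[>] 0, lam * (1 / 2 * g (Φ g)) < ε ^ 2 / 2 := by
    have hc : Continuous fun lam : ℝ => lam * (1 / 2 * g (Φ g)) := by fun_prop
    refine (hc.continuousAt.eventually (gt_mem_nhds ?_)).filter_mono nhdsWithin_le_nhds
    simp only [zero_mul]; positivity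
  filter_upwards [hev, self_mem_nhdsWithin] with lam h1 hlam
  have hlam0 : 0 < lam := hlam
  rw [dist_zero_right, norm_smul, Real.norm_of_nonneg hlam0.le]
  have h2 := sq_norm_smul_solution_le hsymm hpos hlam0 (hR lam hlam0) g
  -- With y = λ‖w‖ ≥ ε, the bound y² < ε²/2 + (ε/2) y is impossible.
  by_contra! hge
  have h3 : ‖h - Φ g‖ * (lam * ‖R lam‖) ≤ ε / 2 * (lam * ‖R lam‖) := by gcongr
  nlinarith

theorem denseRange_of_tendsto_smul {R : ℝ → X → X}
    (hR : ∀ lam, 0 < lam → ∀ h, SolvesResolventEq Φ lam h (R lam h))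
    (hlim : ∀ h, Tendsto (fun lam : ℝ => lam • R lam h) (𝓝[>] 0) (𝓝 0)) : DenseRange Φ := by
  intro h
  have h1 : Tendsto (fun lam : ℝ => h - lam • R lam h) (𝓝[>] 0) (𝓝 h) := by
    simpa using (hlim h).const_sub h
  refine mem_closure_of_tendsto h1 ?_
  filter_upwards [self_mem_nhdsWithin] with lam hlam
  obtain ⟨f, -, hf⟩ := hR lam hlam h
  exact ⟨f, eq_sub_of_add_eq' hf⟩

end Duality

/-! ### Square-integrable operator kernels -/

section Adjoint

variable {X U : Type*} [NormedAddCommGroup X] [NormedSpace ℝ X]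
  [NormedAddCommGroup U] [InnerProductSpace ℝ U] [CompleteSpace U]

theorem inner_adjointB (B : U →L[ℝ] X) (f : StrongDual ℝ X) (u : U) :
    inner ℝ (adjointB B f) u = f (B u) := by
  rw [adjointB, InnerProductSpace.toDual_symm_apply]; rfl

theorem adjointB_add (B : U →L[ℝ] X) (f g : StrongDual ℝ X) :
    adjointB B (f + g) = adjointB B f + adjointB B g := by
  rw [adjointB, ContinuousLinearMap.add_comp, map_add]; rfl

theorem adjointB_smul (B : U →L[ℝ] X) (r : ℝ) (f : StrongDual ℝ X) :
    adjointB B (r • f) = r • adjointB B f := by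
  rw [adjointB, ContinuousLinearMap.smul_comp, map_smulₛₗ]; rfl

theorem norm_adjointB_le (B : U →L[ℝ] X) (f : StrongDual ℝ X) :
    ‖adjointB B f‖ ≤ ‖f‖ * ‖B‖ := by
  rw [adjointB, LinearIsometryEquiv.norm_map]
  exact ContinuousLinearMap.opNorm_comp_le _ _

theorem continuous_adjointB (f : StrongDual ℝ X) :
    Continuous fun B : U →L[ℝ] X => adjointB B f := by
  unfold adjointB
  exact (InnerProductSpace.toDual ℝ U).symm.continuous.comp
    ((ContinuousLinearMap.compL ℝ U X ℝ f).continuous)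

end Adjoint

section Kernel

variable {X U : Type*} [NormedAddCommGroup X] [NormedSpace ℝ X]
  [NormedAddCommGroup U] [InnerProductSpace ℝ U]
  {Ω : Type*} [MeasurableSpace Ω] {μ : Measure Ω} {κ : Ω → U →L[ℝ] X}

theorem integrable_kernel_apply (hκ : MemLp κ 2 μ) {u : Ω → U} (hu : MemLp u 2 μ) :
    Integrable (fun s => κ s (u s)) μ := by
  refine (hκ.norm.integrable_mul hu.norm).mono'
    ((ContinuousLinearMap.id ℝ (U →L[ℝ] X)).aestronglyMeasurable_comp₂ hκ.1 hu.1) ?_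
  exact Eventually.of_forall fun s => (κ s).le_opNorm (u s)

/-- The range of the control operator `u ↦ ∫ κ(s) u(s)` on `L²`. -/
def kernelRange (hκ : MemLp κ 2 μ) : Submodule ℝ X where
  carrier := {y | ∃ u : Ω → U, MemLp u 2 μ ∧ ∫ s, κ s (u s) ∂μ = y}
  zero_mem' := ⟨0, MemLp.zero, by simp⟩
  add_mem' := by
    rintro _ _ ⟨u, hu, rfl⟩ ⟨v, hv, rfl⟩
    refine ⟨u + v, hu.add hv, ?_⟩
    simp only [Pi.add_apply, map_add]
    exact integral_add (integrable_kernel_apply hκ hu) (integrable_kernel_apply hκ hv)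
  smul_mem' := by
    rintro r _ ⟨u, hu, rfl⟩
    refine ⟨r • u, hu.const_smul r, ?_⟩
    simp only [Pi.smul_apply, map_smul]
    exact integral_smul _ _

variable [CompleteSpace U]

theorem memLp_adjointB (hκ : MemLp κ 2 μ) (f : StrongDual ℝ X) :
    MemLp (fun s => adjointB (κ s) f) 2 μ := by
  refine MemLp.of_le_mul (c := ‖f‖) hκ ((continuous_adjointB f).comp_aestronglyMeasurable hκ.1) ?_
  exact Eventually.of_forall fun s => norm_adjointB_le _ _

/-- The Gramian `f ↦ ∫ κ(s) κ(s)* f` of a square-integrable kernel. -/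
def kernelGramian (hκ : MemLp κ 2 μ) : StrongDual ℝ X →ₗ[ℝ] X where
  toFun f := ∫ s, κ s (adjointB (κ s) f) ∂μ
  map_add' f g := by
    simp only [adjointB_add, map_add]
    exact integral_add (integrable_kernel_apply hκ (memLp_adjointB hκ f))
      (integrable_kernel_apply hκ (memLp_adjointB hκ g))
  map_smul' r f := by
    simp only [adjointB_smul, map_smul, RingHom.id_apply]
    exact integral_smul _ _

/-- The value Φf is reached by the control s ↦ κ(s)*f. -/
theorem dense_kernelRange_of_denseRange (hκ : MemLp κ 2 μ) (h : DenseRange (kernelGramian hκ)) :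
    Dense (kernelRange hκ : Set X) := by
  refine Dense.mono ?_ h
  rintro _ ⟨f, rfl⟩
  exact ⟨_, memLp_adjointB hκ f, rfl⟩

variable [CompleteSpace X]

theorem dual_integral_kernel_apply (hκ : MemLp κ 2 μ) {u : Ω → U} (hu : MemLp u 2 μ)
    (f : StrongDual ℝ X) :
    f (∫ s, κ s (u s) ∂μ) = ∫ s, inner ℝ (adjointB (κ s) f) (u s) ∂μ := by
  rw [← ContinuousLinearMap.integral_comp_comm f (integrable_kernel_apply hκ hu)]
  simp only [inner_adjointB]

theorem dual_kernelGramian (hκ : MemLp κ 2 μ) (f g : StrongDual ℝ X) :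
    f (kernelGramian hκ g) = ∫ s, inner ℝ (adjointB (κ s) f) (adjointB (κ s) g) ∂μ :=
  dual_integral_kernel_apply hκ (memLp_adjointB hκ g) f

theorem kernelGramian_symm (hκ : MemLp κ 2 μ) (f g : StrongDual ℝ X) :
    f (kernelGramian hκ g) = g (kernelGramian hκ f) := by
  rw [dual_kernelGramian, dual_kernelGramian]
  simp only [real_inner_comm]

theorem kernelGramian_nonneg (hκ : MemLp κ 2 μ) (f : StrongDual ℝ X) :
    0 ≤ f (kernelGramian hκ f) := by
  rw [dual_kernelGramian]
  exact integral_nonneg fun s => real_inner_self_nonneg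

theorem adjointB_ae_eq_zero (hκ : MemLp κ 2 μ) {f : StrongDual ℝ X}
    (hf : f (kernelGramian hκ f) = 0) : ∀ᵐ s ∂μ, adjointB (κ s) f = 0 := by
  rw [dual_kernelGramian] at hf
  simp only [real_inner_self_eq_norm_sq] at hf
  have hinteg : Integrable (fun s => ‖adjointB (κ s) f‖ ^ 2) μ :=
    (memLp_two_iff_integrable_sq_norm (memLp_adjointB hκ f).1).1 (memLp_adjointB hκ f)
  have h := (integral_eq_zero_iff_of_nonneg (fun s => by positivity) hinteg).1 hf
  filter_upwards [h] with s hs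
  simpa using hs

/-- A functional f annihilating the range kills Φf in particular, so ∫ ‖κ*f‖² = 0. -/
theorem denseRange_kernelGramian (hκ : MemLp κ 2 μ)
    (h : ∀ f : StrongDual ℝ X, (∀ᵐ s ∂μ, adjointB (κ s) f = 0) → f = 0) :
    DenseRange (kernelGramian hκ) := by
  have := dense_of_forall_dual_eq_zero (kernelGramian hκ).range fun f hf =>
    h f (adjointB_ae_eq_zero hκ (hf _ ⟨f, rfl⟩))
  rwa [LinearMap.coe_range] at this

theorem eq_zero_of_dense_kernelRange (hκ : MemLp κ 2 μ) (h : Dense (kernelRange hκ : Set X))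
    {f : StrongDual ℝ X} (hf : ∀ᵐ s ∂μ, adjointB (κ s) f = 0) : f = 0 := by
  have heq : Set.EqOn f (0 : StrongDual ℝ X) (kernelRange hκ : Set X) := by
    rintro _ ⟨u, hu, rfl⟩
    rw [dual_integral_kernel_apply hκ hu, zero_apply]
    refine integral_eq_zero_of_ae ?_
    filter_upwards [hf] with s hs
    rw [hs, inner_zero_left]; rfl
  exact DFunLike.coe_injective (Continuous.ext_on h f.continuous continuous_const heq)

end Kernel

/-! ### Convolution with a weakly singular kernel -/

/-- The function `r ^ (2 (a - 1))` on `(0, ε]`, extended by zero. -/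
def singularWeight (a ε : ℝ) : ℝ → ℝ :=
  (Set.Ioc 0 ε).indicator fun r => r ^ (2 * (a - 1))

theorem integrable_singularWeight {a ε : ℝ} (ha : 1 / 2 < a) (hε : 0 ≤ ε) :
    Integrable (singularWeight a ε) := by
  rw [singularWeight, integrable_indicator_iff measurableSet_Ioc,
    ← intervalIntegrable_iff_integrableOn_Ioc_of_le hε]
  exact intervalIntegral.intervalIntegrable_rpow' (by linarith)

theorem integral_singularWeight {a ε : ℝ} (ha : 1 / 2 < a) (hε : 0 ≤ ε) :
    ∫ r, singularWeight a ε r = ε ^ (2 * a - 1) / (2 * a - 1) := by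
  rw [singularWeight, integral_indicator measurableSet_Ioc,
    ← intervalIntegral.integral_of_le hε, integral_rpow (Or.inl (by linarith))]
  rw [show 2 * (a - 1) + 1 = 2 * a - 1 by ring, Real.zero_rpow (by linarith), sub_zero]

theorem singularWeight_nonneg (a ε r : ℝ) : 0 ≤ singularWeight a ε r :=
  Set.indicator_nonneg (fun _ hr => Real.rpow_nonneg (le_of_lt hr.1) _) r

section Convolution

variable {X U : Type*} [NormedAddCommGroup X] [NormedSpace ℝ X]
  [NormedAddCommGroup U] [InnerProductSpace ℝ U] {k : ℝ → U →L[ℝ] X} {a T D : ℝ}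

theorem aestronglyMeasurable_of_continuousOn_Ioi (hk0 : ∀ r ≤ 0, k r = 0)
    (hkc : ContinuousOn k (Set.Ioi 0)) : AEStronglyMeasurable k := by
  have h : (Set.Ioi (0 : ℝ)).indicator k = k :=
    Set.indicator_eq_self.2 fun r hr => by
      by_contra hr'
      exact hr (hk0 r (not_lt.1 hr'))
  rw [← h, aestronglyMeasurable_indicator_iff measurableSet_Ioi]
  exact hkc.aestronglyMeasurable measurableSet_Ioi

theorem sq_norm_kernel_le (hkb : ∀ r, 0 < r → r ≤ T → ‖k r‖ ≤ D * r ^ (a - 1)) {ε r : ℝ}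
    (hr : 0 < r) (hrT : r ≤ T) (hrε : r ≤ ε) : ‖k r‖ ^ 2 ≤ D ^ 2 * singularWeight a ε r := by
  have hsq : r ^ (2 * (a - 1)) = (r ^ (a - 1)) ^ 2 := by
    rw [mul_comm, Real.rpow_mul hr.le]; norm_cast
  rw [singularWeight, Set.indicator_of_mem (Set.mem_Ioc.2 ⟨hr, hrε⟩), hsq, ← mul_pow]
  exact pow_le_pow_left₀ (norm_nonneg _) (hkb r hr hrT) 2

theorem aestronglyMeasurable_kernel_shift (hk0 : ∀ r ≤ 0, k r = 0)
    (hkc : ContinuousOn k (Set.Ioi 0)) (t : ℝ) :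
    AEStronglyMeasurable (fun s => k (t - s)) :=
  (aestronglyMeasurable_of_continuousOn_Ioi hk0 hkc).comp_measurePreserving
    (Measure.measurePreserving_sub_left volume t)

theorem memLp_kernel_shift (ha : 1 / 2 < a) (hk0 : ∀ r ≤ 0, k r = 0)
    (hkc : ContinuousOn k (Set.Ioi 0))
    (hkb : ∀ r, 0 < r → r ≤ T → ‖k r‖ ≤ D * r ^ (a - 1)) {t : ℝ} (ht : t ∈ Set.Icc 0 T) :
    MemLp (fun s => k (t - s)) 2 (volume.restrict (Set.Ioc 0 T)) := by
  have hm := (aestronglyMeasurable_kernel_shift hk0 hkc t).restrict (s := Set.Ioc 0 T)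
  rw [memLp_two_iff_integrable_sq_norm hm]
  refine Integrable.mono' ((((integrable_singularWeight ha (ht.1.trans ht.2)).comp_sub_left
    t).const_mul (D ^ 2)).restrict (s := Set.Ioc 0 T)) (hm.norm.pow 2) ?_
  filter_upwards [ae_restrict_mem measurableSet_Ioc] with s hs
  rw [Real.norm_of_nonneg (by positivity)]
  rcases le_or_gt (t - s) 0 with h | h
  · rw [hk0 _ h]
    have := mul_nonneg (sq_nonneg D) (singularWeight_nonneg a T (t - s))
    simpa using this
  · exact sq_norm_kernel_le hkb h (by linarith [hs.1, ht.2]) (by linarith [hs.1, ht.2])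

/-- Pointwise ‖k‖‖u‖ ≤ δ‖u‖² + δ⁻¹‖k‖² stands in for Cauchy–Schwarz; the bound is uniform in t. -/
theorem norm_integral_near_diagonal_le (ha : 1 / 2 < a) (hk0 : ∀ r ≤ 0, k r = 0)
    (hkb : ∀ r, 0 < r → r ≤ T → ‖k r‖ ≤ D * r ^ (a - 1)) {u : ℝ → U}
    (hu : MemLp u 2 (volume.restrict (Set.Ioc 0 T))) {t : ℝ} (ht : t ∈ Set.Icc 0 T) {ε δ : ℝ}
    (hε : 0 < ε) (hδ : 0 < δ) :
    ‖∫ s in Set.Ioc 0 T, (Set.Iic ε).indicator k (t - s) (u s)‖ ≤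
      δ * (∫ s in Set.Ioc 0 T, ‖u s‖ ^ 2) + δ⁻¹ * (D ^ 2 * (ε ^ (2 * a - 1) / (2 * a - 1))) := by
  have hu2 : Integrable (fun s => ‖u s‖ ^ 2) (volume.restrict (Set.Ioc 0 T)) :=
    (memLp_two_iff_integrable_sq_norm hu.1).1 hu
  have hw : Integrable (fun s => D ^ 2 * singularWeight a ε (t - s)) :=
    ((integrable_singularWeight ha hε.le).comp_sub_left t).const_mul (D ^ 2)
  have hle : ‖∫ s in Set.Ioc 0 T, (Set.Iic ε).indicator k (t - s) (u s)‖ ≤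
      ∫ s in Set.Ioc 0 T, (δ * ‖u s‖ ^ 2 + δ⁻¹ * (D ^ 2 * singularWeight a ε (t - s))) := by
    refine norm_integral_le_of_norm_le ((hu2.const_mul δ).add (hw.restrict.const_mul δ⁻¹)) ?_
    filter_upwards [ae_restrict_mem measurableSet_Ioc] with s hs
    have hnn : 0 ≤ δ * ‖u s‖ ^ 2 + δ⁻¹ * (D ^ 2 * singularWeight a ε (t - s)) := by
      have := singularWeight_nonneg a ε (t - s)
      positivity
    rcases le_or_gt (t - s) 0 with h | h
    · rw [Set.indicator_apply, hk0 _ h, ite_self]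
      simpa using hnn
    · rcases le_or_gt (t - s) ε with h2 | h2
      · rw [Set.indicator_of_mem (Set.mem_Iic.2 h2)]
        have hk := sq_norm_kernel_le hkb h (by linarith [hs.1, ht.2]) h2
        have hn := (k (t - s)).le_opNorm (u s)
        have hk' := mul_le_mul_of_nonneg_left hk (inv_pos.2 hδ).le
        have hamgm : ‖k (t - s)‖ * ‖u s‖ ≤ δ * ‖u s‖ ^ 2 + δ⁻¹ * ‖k (t - s)‖ ^ 2 := by
          have hx := sq_nonneg (δ * ‖u s‖ - ‖k (t - s)‖)
          have hy : 0 ≤ ‖k (t - s)‖ * ‖u s‖ := by positivity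
          have hz : δ * (‖k (t - s)‖ * ‖u s‖) ≤ (δ * ‖u s‖) ^ 2 + ‖k (t - s)‖ ^ 2 := by
            nlinarith [mul_nonneg hδ.le hy]
          have := mul_le_mul_of_nonneg_left hz (inv_pos.2 hδ).le
          rw [inv_mul_cancel_left₀ hδ.ne'] at this
          refine this.trans_eq ?_
          field_simp
        linarith
      · rw [Set.indicator_of_notMem (Set.notMem_Iic.2 h2)]
        simpa using hnn
  refine hle.trans ?_
  rw [integral_add (hu2.const_mul δ) (hw.restrict.const_mul δ⁻¹), integral_const_mul,
    integral_const_mul]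
  gcongr
  refine (setIntegral_le_integral hw (Eventually.of_forall fun s => ?_)).trans_eq ?_
  · exact mul_nonneg (sq_nonneg D) (singularWeight_nonneg _ _ _)
  · rw [integral_const_mul, integral_sub_left_eq_self (singularWeight a ε) volume t,
      integral_singularWeight ha hε.le]

theorem continuousOn_integral_away_diagonal (ha' : a < 1)
    (hkc : ContinuousOn k (Set.Ioi 0)) (hD : 0 ≤ D)
    (hkb : ∀ r, 0 < r → r ≤ T → ‖k r‖ ≤ D * r ^ (a - 1)) {u : ℝ → U}
    (hu : MemLp u 2 (volume.restrict (Set.Ioc 0 T))) {ε : ℝ} (hε : 0 < ε) :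
    ContinuousOn (fun t => ∫ s in Set.Ioc 0 T, (Set.Ioi ε).indicator k (t - s) (u s))
      (Set.Icc 0 T) := by
  have hm : AEStronglyMeasurable ((Set.Ioi ε).indicator k) := by
    rw [aestronglyMeasurable_indicator_iff measurableSet_Ioi]
    exact (hkc.mono (Set.Ioi_subset_Ioi hε.le)).aestronglyMeasurable measurableSet_Ioi
  have hu1 : Integrable u (volume.restrict (Set.Ioc 0 T)) := hu.integrable (by norm_num)
  intro t₀ ht₀
  refine continuousWithinAt_of_dominated (bound := fun s => (D * ε ^ (a - 1)) * ‖u s‖) ?_ ?_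
    (hu1.norm.const_mul _) ?_
  · exact Eventually.of_forall fun t =>
      (ContinuousLinearMap.id ℝ (U →L[ℝ] X)).aestronglyMeasurable_comp₂
        (hm.comp_measurePreserving (Measure.measurePreserving_sub_left volume t)).restrict hu.1
  · filter_upwards [self_mem_nhdsWithin] with t ht
    filter_upwards [ae_restrict_mem measurableSet_Ioc] with s hs
    refine ContinuousLinearMap.le_of_opNorm_le _ ?_ _
    rcases le_or_gt (t - s) ε with h | h
    · rw [Set.indicator_of_notMem (Set.notMem_Ioi.2 h), norm_zero]
      positivity
    · rw [Set.indicator_of_mem (Set.mem_Ioi.2 h)]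
      refine (hkb _ (hε.trans h) (by linarith [hs.1, ht.2])).trans ?_
      exact mul_le_mul_of_nonneg_left
        (Real.rpow_le_rpow_of_nonpos hε h.le (by linarith)) hD
  -- The truncated kernel jumps only at r = ε, which is met at the single point s = t₀ - ε.
  · have hne : ∀ᵐ s ∂(volume.restrict (Set.Ioc 0 T)), s ≠ t₀ - ε :=
      ae_restrict_of_ae (Measure.ae_ne volume (t₀ - ε))
    filter_upwards [hne] with s hs
    have hc : ContinuousAt ((Set.Ioi ε).indicator k) (t₀ - s) := by
      rcases lt_trichotomy (t₀ - s) ε with h | h | h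
      · refine continuousAt_const (y := (0 : U →L[ℝ] X)) |>.congr ?_
        filter_upwards [Iio_mem_nhds h] with r hr
        rw [Set.indicator_of_notMem (by simpa using (le_of_lt hr))]
      · exact absurd (by linarith) hs
      · refine (hkc.continuousAt (Ioi_mem_nhds (hε.trans h))).congr ?_
        filter_upwards [Ioi_mem_nhds h] with r hr
        rw [Set.indicator_of_mem hr]
    have hc' : ContinuousAt (fun t => (Set.Ioi ε).indicator k (t - s)) t₀ :=
      ContinuousAt.comp (f := fun t => t - s) (x := t₀) hc (by fun_prop)
    exact (hc'.clm_apply continuousAt_const).continuousWithinAt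

/-- The convolution of a kernel of order `r ^ (a - 1)`, `a > 1 / 2`, with an `L²` function is
continuous. -/
theorem continuousOn_integral_kernel_shift (ha : 1 / 2 < a) (ha' : a < 1)
    (hk0 : ∀ r ≤ 0, k r = 0) (hkc : ContinuousOn k (Set.Ioi 0)) (hD : 0 ≤ D)
    (hkb : ∀ r, 0 < r → r ≤ T → ‖k r‖ ≤ D * r ^ (a - 1)) {u : ℝ → U}
    (hu : MemLp u 2 (volume.restrict (Set.Ioc 0 T))) :
    ContinuousOn (fun t => ∫ s in Set.Ioc 0 T, k (t - s) (u s)) (Set.Icc 0 T) := by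
  set N := ∫ s in Set.Ioc 0 T, ‖u s‖ ^ 2 with hN
  have hlim : Tendsto (fun ε : ℝ => ε ^ (a - 1 / 2) * (N + D ^ 2 / (2 * a - 1))) (𝓝[>] 0)
      (𝓝 0) := by
    have h := (Real.continuous_rpow_const (by linarith : 0 ≤ a - 1 / 2)).tendsto 0
    rw [Real.zero_rpow (by linarith)] at h
    simpa using (h.mono_left nhdsWithin_le_nhds).mul_const (N + D ^ 2 / (2 * a - 1))
  have hunif : TendstoUniformlyOn
      (fun ε t => ∫ s in Set.Ioc 0 T, (Set.Ioi ε).indicator k (t - s) (u s))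
      (fun t => ∫ s in Set.Ioc 0 T, k (t - s) (u s)) (𝓝[>] (0 : ℝ)) (Set.Icc 0 T) := by
    rw [Metric.tendstoUniformlyOn_iff]
    intro η hη
    filter_upwards [hlim.eventually (gt_mem_nhds hη), self_mem_nhdsWithin] with ε hε1 hε t ht
    have hε0 : 0 < ε := hε
    have hκ := memLp_kernel_shift ha hk0 hkc hkb ht
    have hsplit : ∀ r, k r = (Set.Iic ε).indicator k r + (Set.Ioi ε).indicator k r := by
      intro r
      rw [← Set.compl_Iic]
      exact (congrFun (Set.indicator_self_add_compl (Set.Iic ε) k) r).symm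
    have hi2 : Integrable (fun s => (Set.Ioi ε).indicator k (t - s) (u s))
        (volume.restrict (Set.Ioc 0 T)) := by
      have h1 : (fun s => (Set.Ioi ε).indicator k (t - s) (u s)) =
          (Set.Iio (t - ε)).indicator fun s => k (t - s) (u s) := by
        ext s
        by_cases h : s < t - ε
        · rw [Set.indicator_of_mem (Set.mem_Ioi.2 (by linarith)),
            Set.indicator_of_mem (Set.mem_Iio.2 h)]
        · rw [Set.indicator_of_notMem (by rw [Set.mem_Ioi]; intro h'; exact h (by linarith)),
            Set.indicator_of_notMem (by simpa using h)]
          rfl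
      rw [h1]
      exact (integrable_kernel_apply hκ hu).indicator measurableSet_Iio
    rw [dist_eq_norm, ← integral_sub (integrable_kernel_apply hκ hu) hi2]
    have heq : ∀ s, k (t - s) (u s) - (Set.Ioi ε).indicator k (t - s) (u s) =
        (Set.Iic ε).indicator k (t - s) (u s) := fun s => by
      rw [← sub_apply]
      congr 1
      exact sub_eq_of_eq_add (hsplit (t - s))
    simp only [heq]
    -- The choice δ = ε^(a-1/2) balances both terms, since ε^(2a-1) = δ².
    refine (norm_integral_near_diagonal_le ha hk0 hkb hu ht hε0
      (Real.rpow_pos_of_pos hε0 (a - 1 / 2))).trans_lt (lt_of_eq_of_lt ?_ hε1)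
    have hp : ε ^ (2 * a - 1) = ε ^ (a - 1 / 2) * ε ^ (a - 1 / 2) := by
      rw [← Real.rpow_add hε0]; ring_nf
    have hpos := Real.rpow_pos_of_pos hε0 (a - 1 / 2)
    rw [hp, ← hN]
    field_simp
  refine hunif.continuousOn (Eventually.frequently ?_)
  filter_upwards [self_mem_nhdsWithin] with ε hε
  exact continuousOn_integral_away_diagonal ha' hkc hD hkb hu hε

end Convolution

/-! ### The control system -/

section System

variable {X U : Type*} [NormedAddCommGroup X] [NormedSpace ℝ X]
  [NormedAddCommGroup U] [InnerProductSpace ℝ U] {S : ℝ → X →L[ℝ] X} {B : U →L[ℝ] X} {a T : ℝ}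

/-- The kernel `r ^ (a - 1) T̂_a(r) B` of the control operator, extended by zero to `r ≤ 0`. -/
def controlKernel (S : ℝ → X →L[ℝ] X) (B : U →L[ℝ] X) (a : ℝ) : ℝ → U →L[ℝ] X :=
  (Set.Ioi 0).indicator fun r => r ^ (a - 1) • (hatT S a r).comp B

theorem controlKernel_of_pos {r : ℝ} (hr : 0 < r) :
    controlKernel S B a r = r ^ (a - 1) • (hatT S a r).comp B :=
  Set.indicator_of_mem (Set.mem_Ioi.2 hr) _

theorem controlKernel_of_nonpos {r : ℝ} (hr : r ≤ 0) : controlKernel S B a r = 0 :=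
  Set.indicator_of_notMem (Set.notMem_Ioi.2 hr) _

theorem controlKernel_apply (ha : a < 1) {r : ℝ} (hr : 0 ≤ r) (u : U) :
    controlKernel S B a r u = r ^ (a - 1) • hatT S a r (B u) := by
  rcases hr.eq_or_lt with rfl | hr
  · rw [controlKernel_of_nonpos le_rfl, Real.zero_rpow (by linarith), zero_smul]; rfl
  · rw [controlKernel_of_pos hr]; rfl

/-- Extension of the kernel by zero turns the Volterra integral into one over the fixed interval
(0,T]. -/
theorem integral_controlKernel (ha : a < 1) {t : ℝ} (ht : t ∈ Set.Icc 0 T) (u : ℝ → U) :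
    ∫ s in (0 : ℝ)..t, (t - s) ^ (a - 1) • hatT S a (t - s) (B (u s)) =
      ∫ s in Set.Ioc 0 T, controlKernel S B a (t - s) (u s) := by
  rw [intervalIntegral.integral_of_le ht.1,
    setIntegral_eq_of_subset_of_forall_sdiff_eq_zero measurableSet_Ioc
      (Set.Ioc_subset_Ioc_right ht.2) (f := fun s => controlKernel S B a (t - s) (u s))]
  · refine setIntegral_congr_fun measurableSet_Ioc fun s hs => ?_
    exact (controlKernel_apply ha (by linarith [hs.2]) _).symm
  · intro s hs
    have hst : t < s := by
      by_contra! h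
      exact hs.2 ⟨hs.1.1, h⟩
    rw [controlKernel_of_nonpos (by linarith)]; rfl

theorem adjointB_controlKernel [CompleteSpace U] {r : ℝ} (hr : 0 < r) (f : StrongDual ℝ X) :
    adjointB (controlKernel S B a r) f = r ^ (a - 1) • obsOp S B a r f := by
  rw [controlKernel_of_pos hr, obsOp, ← adjointB_smul]
  unfold adjointB
  congr 1
  ext u
  simp

variable [CompleteSpace X]

theorem continuousOn_controlKernel (hS : IsC0Semigroup S) (ha : 0 < a) (ha' : a < 1) :
    ContinuousOn (controlKernel S B a) (Set.Ioi 0) := by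
  have h : ContinuousOn (fun r : ℝ => r ^ (a - 1) • (hatT S a r).comp B) (Set.Ioi 0) :=
    (continuousOn_id.rpow_const fun r hr => Or.inl (ne_of_gt hr)).smul
      ((continuousOn_hatT hS ha ha').clm_comp continuousOn_const)
  exact h.congr fun r hr => controlKernel_of_pos hr

theorem exists_norm_controlKernel_le (hS : IsC0Semigroup S) (ha : 0 < a) (ha' : a < 1)
    (B : U →L[ℝ] X) (T : ℝ) :
    ∃ D : ℝ, 0 ≤ D ∧ ∀ r, 0 < r → r ≤ T → ‖controlKernel S B a r‖ ≤ D * r ^ (a - 1) := by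
  obtain ⟨D, hD, h⟩ := exists_norm_hatT_le hS ha ha' T
  refine ⟨D * ‖B‖, by positivity, fun r hr hrT => ?_⟩
  rw [controlKernel_of_pos hr, norm_smul, Real.norm_of_nonneg (Real.rpow_nonneg hr.le _), mul_comm]
  gcongr
  exact (ContinuousLinearMap.opNorm_comp_le _ _).trans (by gcongr; exact h r hr.le hrT)

theorem memLp_controlKernel (hS : IsC0Semigroup S) (ha : 1 / 2 < a) (ha' : a < 1) (hT : 0 ≤ T)
    (B : U →L[ℝ] X) :
    MemLp (fun s => controlKernel S B a (T - s)) 2 (volume.restrict (Set.Ioc 0 T)) := by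
  obtain ⟨D, -, hD⟩ := exists_norm_controlKernel_le hS (by linarith) ha' B T
  exact memLp_kernel_shift ha (fun r hr => controlKernel_of_nonpos hr)
    (continuousOn_controlKernel hS (by linarith) ha') hD ⟨hT, le_rfl⟩

theorem exists_isMildSolution (hS : IsC0Semigroup S) (ha : 1 / 2 < a) (ha' : a < 1)
    (ζ : X) {u : ℝ → U} (hu : MemLp u 2 (volume.restrict (Set.Ioc 0 T))) :
    ∃ x, IsMildSolution S B a T ζ u x := by
  obtain ⟨D, hD0, hD⟩ := exists_norm_controlKernel_le hS (by linarith) ha' B T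
  have hcont := continuousOn_integral_kernel_shift ha ha'
    (fun r hr => controlKernel_of_nonpos (S := S) (B := B) hr)
    (continuousOn_controlKernel hS (by linarith) ha') hD0 hD hu
  refine ⟨fun t => fracT S a t ζ + ∫ s in Set.Ioc 0 T, controlKernel S B a (t - s) (u s),
    (continuousOn_fracT hS (by linarith) ha' T ζ).add hcont, fun t ht => ?_⟩
  rw [integral_controlKernel ha' ht]

theorem reachableSet_eq (hS : IsC0Semigroup S) (ha : 1 / 2 < a) (ha' : a < 1) (hT : 0 ≤ T)
    (ζ : X) :
    reachableSet S B a T ζ = (fun y => fracT S a T ζ + y) ''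
      (kernelRange (memLp_controlKernel hS ha ha' hT B) : Set X) := by
  have hμ : volume.restrict (Set.Icc 0 T) = volume.restrict (Set.Ioc 0 T) :=
    Measure.restrict_congr_set Ioc_ae_eq_Icc.symm
  have hTT : T ∈ Set.Icc 0 T := ⟨hT, le_rfl⟩
  ext y
  constructor
  · rintro ⟨u, x, hu, hx, rfl⟩
    rw [hμ] at hu
    refine ⟨_, ⟨u, hu, rfl⟩, ?_⟩
    rw [hx.2 T hTT, integral_controlKernel ha' hTT]
  · rintro ⟨_, ⟨u, hu, rfl⟩, rfl⟩
    obtain ⟨x, hx⟩ := exists_isMildSolution (B := B) hS ha ha' ζ hu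
    refine ⟨u, x, by rwa [hμ], hx, ?_⟩
    rw [hx.2 T hTT, integral_controlKernel ha' hTT]

/-- The reachable set is a translate of a fixed subspace, so ζ plays no role. -/
theorem approxControllableFrom_iff (hS : IsC0Semigroup S) (ha : 1 / 2 < a) (ha' : a < 1)
    (hT : 0 ≤ T) (ζ : X) :
    ApproxControllableFrom S B a T ζ ↔
      Dense (kernelRange (memLp_controlKernel hS ha ha' hT B) : Set X) := by
  let e := Homeomorph.addLeft (fracT S a T ζ)
  rw [ApproxControllableFrom, dense_iff_closure_eq, reachableSet_eq hS ha ha' hT]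
  change closure (e '' _) = _ ↔ _
  have huniv : e '' Set.univ = Set.univ := by rw [Set.image_univ, e.range_coe]
  rw [← e.image_closure]
  nth_rewrite 1 [← huniv]
  exact e.injective.image_injective.eq_iff

variable [CompleteSpace U]

theorem gramian_eq_kernelGramian (hS : IsC0Semigroup S) (ha : 1 / 2 < a) (ha' : a < 1)
    (hT : 0 ≤ T) :
    gramian S B a T = kernelGramian (memLp_controlKernel hS ha ha' hT B) := by
  funext f
  refine (intervalIntegral.integral_of_le hT).trans
    (setIntegral_congr_fun measurableSet_Ioc fun s hs => ?_)
  -- At s = T both integrands are 0, since `0 ^ x = 0` for x ≠ 0.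
  rcases hs.2.eq_or_lt with rfl | hlt
  · simp only [sub_self]
    rw [Real.zero_rpow (by linarith), zero_smul, controlKernel_of_nonpos le_rfl]; rfl
  · have hr : 0 < T - s := by linarith
    simp only
    rw [adjointB_controlKernel hr, controlKernel_apply ha' hr.le, map_smul, map_smul, smul_smul,
      ← Real.rpow_add hr]
    ring_nf

theorem continuousOn_obsOp (hS : IsC0Semigroup S) (ha : 0 < a) (ha' : a < 1) (B : U →L[ℝ] X)
    (f : StrongDual ℝ X) : ContinuousOn (fun r => obsOp S B a r f) (Set.Ioi 0) := by
  have h : ContinuousOn (fun r => (hatT S a r).comp B) (Set.Ioi 0) :=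
    (continuousOn_hatT hS ha ha').clm_comp continuousOn_const
  refine ((continuous_adjointB f).comp_continuousOn h).congr fun r _ => ?_
  rw [obsOp, adjointB, ContinuousLinearMap.comp_assoc]
  rfl

/-- The scalar factor is nonzero for s < T, and continuity on [0,T) upgrades almost everywhere to
everywhere. -/
theorem adjointB_controlKernel_ae_eq_zero_iff (hS : IsC0Semigroup S) (ha : 0 < a) (ha' : a < 1)
    (f : StrongDual ℝ X) :
    (∀ᵐ s ∂(volume.restrict (Set.Ioc 0 T)), adjointB (controlKernel S B a (T - s)) f = 0) ↔
      ∀ t : ℝ, 0 ≤ t → t < T → obsOp S B a (T - t) f = 0 := by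
  have hμ : volume.restrict (Set.Ioc 0 T) = volume.restrict (Set.Ico 0 T) :=
    Measure.restrict_congr_set Ico_ae_eq_Ioc.symm
  rw [hμ]
  constructor
  · intro h t ht htT
    refine Measure.eqOn_Ico_of_ae_eq (μ := volume) (a := 0) (b := T)
      (f := fun t => obsOp S B a (T - t) f) (g := fun _ => 0) ?_ ?_ continuousOn_const ⟨ht, htT⟩
    · filter_upwards [h, ae_restrict_mem measurableSet_Ico] with s hs hsT
      have hr : 0 < T - s := by linarith [hsT.2]
      rw [adjointB_controlKernel hr] at hs
      exact (smul_eq_zero.1 hs).resolve_left (Real.rpow_pos_of_pos hr _).ne'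
    · exact (continuousOn_obsOp hS ha ha' B f).comp (f := fun t : ℝ => T - t) (by fun_prop)
        fun s hs => sub_pos.2 hs.2
  · intro h
    filter_upwards [ae_restrict_mem measurableSet_Ico] with s hs
    rw [adjointB_controlKernel (sub_pos.2 hs.2), h s hs.1 hs.2, smul_zero]

end System

end FracControl

end

/-! ### The equivalences -/

theorem lemma3p3 {X U : Type*}
    [NormedAddCommGroup X] [NormedSpace ℝ X] [CompleteSpace X]
    [TopologicalSpace.SeparableSpace X]
    (hrefl : Function.Surjective (NormedSpace.inclusionInDoubleDual ℝ X))
    [StrictConvexSpace ℝ (StrongDual ℝ X)]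
    [NormedAddCommGroup U] [InnerProductSpace ℝ U] [CompleteSpace U]
    [TopologicalSpace.SeparableSpace U]
    (A : X →ₗ.[ℝ] X) (S : ℝ → X →L[ℝ] X) (hS : FracControl.IsC0Semigroup S)
    (hA : FracControl.IsInfinitesimalGenerator A S)
    (B : U →L[ℝ] X) (α T : ℝ) (hα : 1 / 2 < α) (hα' : α < 1) (hT : 0 < T) :
    -- the operators `T̂_α(t)` are well defined, bounded and given by their integral formula
    (∀ t : ℝ, 0 ≤ t → ∀ x : X,
      IntegrableOn (fun ξ : ℝ => (ξ * FracControl.subordDensity α ξ) • S (t ^ α * ξ) x)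
        (Set.Ioi 0) ∧
      FracControl.hatT S α t x =
        α • ∫ ξ in Set.Ioi (0 : ℝ), (ξ * FracControl.subordDensity α ξ) • S (t ^ α * ξ) x) ∧
    -- the resolvent `(λ I + Φ₀ᵀ J)⁻¹` is a well-defined single-valued map on `X`
    (∀ lam : ℝ, 0 < lam → ∀ h : X,
      ∃! w : X, FracControl.SolvesResolventEq (FracControl.gramian S B α T) lam h w) ∧
    -- approximate controllability is equivalent to (H0)
    (FracControl.ApproxControllable S B α T ↔ FracControl.H0 S B α T) ∧
    -- the same for each fixed initial state
    (∀ ζ : X, FracControl.ApproxControllableFrom S B α T ζ ↔ FracControl.H0 S B α T) ∧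
    -- and equivalent to the dual uniqueness condition
    (FracControl.ApproxControllable S B α T ↔
      ∀ f : StrongDual ℝ X,
        (∀ t : ℝ, 0 ≤ t → t < T → FracControl.obsOp S B α (T - t) f = 0) → f = 0) := by
  open FracControl in
  have hα0 : 0 < α := by linarith
  have hκ := memLp_controlKernel hS hα hα' hT.le B
  have hsymm := kernelGramian_symm hκ
  have hpos := kernelGramian_nonneg hκ
  have hgram : gramian S B α T = kernelGramian hκ := gramian_eq_kernelGramian hS hα hα' hT.le
  have hsolve : ∀ lam : ℝ, 0 < lam → ∀ h : X,
      ∃! w : X, SolvesResolventEq (gramian S B α T) lam h w := fun lam hlam h => by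
    rw [hgram]
    exact existsUnique_solvesResolventEq hsymm hpos hlam h
  have hres : ∀ lam : ℝ, 0 < lam → ∀ h : X,
      SolvesResolventEq (kernelGramian hκ) lam h (resolventOp (gramian S B α T) lam h) :=
    fun lam hlam h => by
      rw [← hgram]
      exact Classical.epsilon_spec (hsolve lam hlam h).exists
  have hfrom : ∀ ζ : X, ApproxControllableFrom S B α T ζ ↔ Dense (kernelRange hκ : Set X) :=
    approxControllableFrom_iff hS hα hα' hT.le
  have hall : ApproxControllable S B α T ↔ Dense (kernelRange hκ : Set X) :=
    ⟨fun h => (hfrom 0).1 (h 0), fun h ζ => (hfrom ζ).2 h⟩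
  have hdual : Dense (kernelRange hκ : Set X) ↔ ∀ f : StrongDual ℝ X,
      (∀ t : ℝ, 0 ≤ t → t < T → obsOp S B α (T - t) f = 0) → f = 0 := by
    constructor
    · intro h f hf
      exact eq_zero_of_dense_kernelRange hκ h
        ((adjointB_controlKernel_ae_eq_zero_iff hS hα0 hα' f).2 hf)
    · intro h
      exact dense_kernelRange_of_denseRange hκ (denseRange_kernelGramian hκ fun f hf =>
        h f ((adjointB_controlKernel_ae_eq_zero_iff hS hα0 hα' f).1 hf))
  -- Both directions pass through density of the range of the Gramian.
  have hH0 : Dense (kernelRange hκ : Set X) ↔ H0 S B α T := by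
    constructor
    · intro h x
      exact tendsto_smul_of_denseRange hsymm hpos
        (denseRange_kernelGramian hκ fun f hf => eq_zero_of_dense_kernelRange hκ h hf) x
        fun lam hlam => hres lam hlam x
    · intro h
      exact dense_kernelRange_of_denseRange hκ (denseRange_of_tendsto_smul hres h)
  exact ⟨fun t ht x => ⟨integrableOn_mul_subordDensity_smul hS hα0 hα' (Real.rpow_nonneg ht α) x,
    hatT_apply hS hα0 hα' ht x⟩, hsolve, hall.trans hH0, fun ζ => (hfrom ζ).trans hH0,
    hall.trans hdual⟩
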